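/- Let $a\in\mathbb{C}$, put $\mathfrak{q}=\exp(a)$ and $\mathfrak{q}_k=\exp(a/k)$ for $k\in\mathbb{Z}_{>0}$ (so $\mathfrak{q}$ is an arbitrary non-zero complex number, possibly a root of unity). Let $\mathcal{R}_k=\mathbb{C}[\![y_k]\!]\subset\mathcal{K}_k=\mathbb{C}(\!(y_k)\!)$, with the inclusions $\mathcal{K}_m\subset\mathcal{K}_{mn}$ given by $y_m=y_{mn}^n$, and let $\Phi^*$ be the automorphism $f(y_k)\mapsto f(\mathfrak{q}_k y_k)$ of $\mathcal{K}_k$. A $\mathfrak{q}_m$-difference $\mathcal{K}_m$-module is a finite-dimensional $\mathcal{K}_m$-vector space $\mathcal{V}$ with a $\mathbb{C}$-linear automorphism $\Phi^*$ such that $\Phi^*(fs)=\Phi^*(f)\Phi^*(s)$ for all $f\in\mathcal{K}_m$, $s\in\mathcal{V}$; it induces $\Phi^*\otimes\Phi^*$ on $\mathcal{V}\otimes_{\mathcal{K}_m}\mathcal{K}_{mn}$, which is again denoted $\Phi^*$. For $\omega\in\mathbb{Q}$, $(\mathcal{V},\Phi^*)$ is called pure isoclinic of slope $\omega$ if for every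 $m_1\in m\mathbb{Z}_{>0}$ with $m_1\omega\in\mathbb{Z}$ there is an $\mathcal{R}_{m_1}$-lattice $\mathcal{L}\subset\mathcal{V}\otimes_{\mathcal{K}_m}\mathcal{K}_{m_1}$ (a finitely generated $\mathcal{R}_{m_1}$-submodule spanning it over $\mathcal{K}_{m_1}$) such that $y_{m_1}^{m_1\omega}\Phi^*(\mathcal{L})=\mathcal{L}$. Proposition. For every $m\in\mathbb{Z}_{>0}$, every $\mathfrak{q}_m$-difference $\mathcal{K}_m$-module $(\mathcal{V},\Phi^*)$ has a slope decomposition: there are $\mathcal{K}_m$-subspaces $\mathcal{V}_\omega\subset\mathcal{V}$ $(\omega\in\mathbb{Q})$ with $\Phi^*(\mathcal{V}_\omega)=\mathcal{V}_\omega$ and $\mathcal{V}=\bigoplus_{\omega\in\mathbb{Q}}\mathcal{V}_\omega$, such that each $(\mathcal{V}_\omega,\Phi^*)$ is pure isoclinic of slope $\omega$. -/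

import Mathlib

open scoped TensorProduct PowerSeries

noncomputable section

namespace QDiff

/-- The field `𝒦_m = ℂ((y_m))` of formal Laurent series in the variable `y_m`. It is a copy of
`LaurentSeries ℂ`, tagged by `m` so that `𝒦_m` and `𝒦_{mn}` are not confused. -/
def K (_m : ℕ+) : Type := LaurentSeries ℂ

instance (m : ℕ+) : Field (K m) := inferInstanceAs (Field (LaurentSeries ℂ))

/-- `ℂ⟦X⟧` plays the role of `ℛ_m = ℂ⟦y_m⟧` for every `m`, with `X` mapped to `y_m` in `𝒦_m`. -/
instance (m : ℕ+) : Algebra ℂ⟦X⟧ (K m) := inferInstanceAs (Algebra ℂ⟦X⟧ (LaurentSeries ℂ))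

/-- The variable `y_m`, as an element of `𝒦_m`. -/
def y (m : ℕ+) : K m := (HahnSeries.single (1 : ℤ) (1 : ℂ) : LaurentSeries ℂ)

/-- Substitution `f(y) ↦ f(c y)` on Laurent series: the coefficient of `y ^ k` gets multiplied
by `c ^ k`. -/
def dilateFun (c : ℂˣ) (f : LaurentSeries ℂ) : LaurentSeries ℂ where
  coeff k := (c : ℂ) ^ k * f.coeff k
  isPWO_support' := f.isPWO_support.mono fun _ hk => right_ne_zero_of_mul hk

theorem coeff_dilateFun (c : ℂˣ) (f : LaurentSeries ℂ) (k : ℤ) :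
    (dilateFun c f).coeff k = (c : ℂ) ^ k * f.coeff k := rfl

theorem support_dilateFun (c : ℂˣ) (f : LaurentSeries ℂ) :
    (dilateFun c f).support ⊆ f.support := fun _ hk => right_ne_zero_of_mul hk

/-- The substitution `f(y) ↦ f(c y)` as a ring homomorphism. -/
def dilate (c : ℂˣ) : LaurentSeries ℂ →+* LaurentSeries ℂ where
  toFun := dilateFun c
  map_zero' := by ext k; simp [coeff_dilateFun]
  map_one' := by
    ext k
    by_cases hk : k = 0 <;> simp [coeff_dilateFun, HahnSeries.coeff_one, hk]
  map_add' f g := by ext k; simp [coeff_dilateFun, mul_add]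
  map_mul' f g := by
    ext k
    have h2 : (dilateFun c f * dilateFun c g).coeff k =
        ∑ ij ∈ Finset.antidiagonal f.isPWO_support g.isPWO_support k,
          (dilateFun c f).coeff ij.1 * (dilateFun c g).coeff ij.2 := by
      rw [HahnSeries.coeff_mul_left' f.isPWO_support (support_dilateFun c f)]
      refine Finset.sum_subset (fun ij hij => ?_) (fun ij _ hij => ?_)
      · rw [Finset.mem_antidiagonal] at hij ⊢
        exact ⟨hij.1, support_dilateFun c g hij.2.1, hij.2.2⟩
      · rename_i h0
        rw [Finset.mem_antidiagonal] at h0 hij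
        by_contra hne
        exact hij ⟨h0.1, right_ne_zero_of_mul hne, h0.2.2⟩
    rw [h2, coeff_dilateFun, HahnSeries.coeff_mul, Finset.mul_sum]
    refine Finset.sum_congr rfl fun ij hij => ?_
    rw [Finset.mem_antidiagonal] at hij
    rw [coeff_dilateFun, coeff_dilateFun, ← hij.2.2, zpow_add₀ c.ne_zero]
    ring

@[simp]
theorem coeff_dilate (c : ℂˣ) (f : LaurentSeries ℂ) (k : ℤ) :
    (dilate c f).coeff k = (c : ℂ) ^ k * f.coeff k := rfl

/-- `𝔮_m = exp (a / m)`; here `𝔮 = exp a` is an arbitrary nonzero complex number, together with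
a choice `a` of its logarithm. -/
def qRoot (a : ℂ) (m : ℕ+) : ℂˣ := Units.mk0 (Complex.exp (a / (m : ℕ))) (Complex.exp_ne_zero _)

/-- The automorphism `Φ^*` of `𝒦_m`, given by `f(y_m) ↦ f(𝔮_m y_m)`. -/
def shift (a : ℂ) (m : ℕ+) : K m →+* K m := dilate (qRoot a m)

/-- The inverse `f(y_m) ↦ f(𝔮_m⁻¹ y_m)` of `shift a m`. -/
def shiftInv (a : ℂ) (m : ℕ+) : K m →+* K m := dilate (qRoot a m)⁻¹

theorem dilate_comp_inv (c : ℂˣ) : (dilate c).comp (dilate c⁻¹) = RingHom.id _ := by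
  refine RingHom.ext fun f => HahnSeries.ext (funext fun k => ?_)
  have hc : (c : ℂ) ^ k ≠ 0 := zpow_ne_zero _ c.ne_zero
  simp [hc]

instance (a : ℂ) (m : ℕ+) : RingHomInvPair (shift a m) (shiftInv a m) where
  comp_eq := by
    have h := dilate_comp_inv (qRoot a m)⁻¹
    rw [inv_inv] at h
    exact h
  comp_eq₂ := dilate_comp_inv (qRoot a m)

instance (a : ℂ) (m : ℕ+) : RingHomInvPair (shiftInv a m) (shift a m) where
  comp_eq := dilate_comp_inv (qRoot a m)
  comp_eq₂ := by
    have h := dilate_comp_inv (qRoot a m)⁻¹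
    rw [inv_inv] at h
    exact h

/-- Multiplication by `n` on exponents. -/
def mulEmb (n : ℕ+) : ℤ ↪o ℤ :=
  OrderEmbedding.ofMapLEIff (fun k => (n : ℤ) * k)
    (fun _ _ => mul_le_mul_iff_right₀ (by exact_mod_cast n.pos))

/-- Substitution `f(y) ↦ f(y ^ n)` on Laurent series. -/
def expand (n : ℕ+) : LaurentSeries ℂ →+* LaurentSeries ℂ where
  toFun := HahnSeries.embDomain (mulEmb n)
  map_zero' := HahnSeries.embDomain_zero
  map_one' := HahnSeries.embDomain_one _ (mul_zero _)
  map_add' := HahnSeries.embDomain_add _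
  map_mul' := HahnSeries.embDomain_mul _ (mul_add _)

/-- The inclusion `𝒦_m ⊆ 𝒦_{mn}`, given by `y_m ↦ (y_{mn}) ^ n`. -/
def ramify (m n : ℕ+) : K m →+* K (m * n) := expand n

instance (m n : ℕ+) : Algebra (K m) (K (m * n)) := (ramify m n).toAlgebra

theorem dilate_expand (c d : ℂˣ) (n : ℕ+) (h : c ^ (n : ℤ) = d) (f : LaurentSeries ℂ) :
    dilate c (expand n f) = expand n (dilate d f) := by
  subst h
  ext k
  change (c : ℂ) ^ k * (HahnSeries.embDomain (mulEmb n) f).coeff k =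
    (HahnSeries.embDomain (mulEmb n) (dilate (c ^ (n : ℤ)) f)).coeff k
  by_cases hk : k ∈ Set.range (mulEmb n)
  · obtain ⟨j, rfl⟩ := hk
    rw [HahnSeries.embDomain_coeff, HahnSeries.embDomain_coeff, coeff_dilate,
      Units.val_zpow_eq_zpow_val, ← zpow_mul]
    rfl
  · rw [HahnSeries.embDomain_of_notMem_range hk, HahnSeries.embDomain_of_notMem_range hk, mul_zero]

theorem qRoot_pow (a : ℂ) (m n : ℕ+) : qRoot a (m * n) ^ (n : ℤ) = qRoot a m := by
  have hn : ((n : ℕ) : ℂ) ≠ 0 := by exact_mod_cast n.ne_zero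
  have hm : ((m : ℕ) : ℂ) ≠ 0 := by exact_mod_cast m.ne_zero
  ext
  simp only [qRoot, Units.val_zpow_eq_zpow_val, Units.val_mk0, ← Complex.exp_int_mul]
  congr 1
  push_cast
  field_simp

/-- The inclusion `𝒦_m ⊆ 𝒦_{mn}` commutes with the automorphisms `Φ^*`. -/
theorem shift_ramify (a : ℂ) (m n : ℕ+) (f : K m) :
    shift a (m * n) (ramify m n f) = ramify m n (shift a m f) :=
  dilate_expand _ _ n (qRoot_pow a m n) f

/-- `Φ^*` on `𝒦_{mn}`, as a semilinear automorphism over `𝒦_m`. -/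
def shiftEquiv (a : ℂ) (m n : ℕ+) : K (m * n) ≃ₛₗ[shift a m] K (m * n) where
  toFun := shift a (m * n)
  invFun := shiftInv a (m * n)
  map_add' := map_add _
  map_smul' f g := by
    rw [Algebra.smul_def, Algebra.smul_def, map_mul]
    exact congrArg (· * _) (shift_ramify a m n f)
  left_inv f := RingHomInvPair.comp_apply_eq
  right_inv f := RingHomInvPair.comp_apply_eq₂

instance (m n : ℕ+) : SMulCommClass ℂ⟦X⟧ (K m) (K (m * n)) where
  smul_comm r f g := by
    simp only [Algebra.smul_def]
    ring

section Modules

variable {V : Type*} [AddCommGroup V]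

/-- A difference operator `Φ^*` on a `𝒦_m`-vector space `V`: a bijective additive map with
`Φ^*(f s) = Φ^*(f) Φ^*(s)`. It is `ℂ`-linear, since `shift a m` fixes the constants.
A `𝔮_m`-difference `𝒦_m`-module is a finite-dimensional `V` with such an operator. -/
abbrev Operator (a : ℂ) (m : ℕ+) (V : Type*) [AddCommGroup V] [Module (K m) V] :=
  V ≃ₛₗ[shift a m] V

/-- The pull-back to `𝒦_{mn}`: the operator `g ⊗ s ↦ Φ^*(g) ⊗ Φ^*(s)` on
`𝒦_{mn} ⊗_{𝒦_m} V`. -/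
def pullback {a : ℂ} {m : ℕ+} [Module (K m) V] (n : ℕ+) (Φ : Operator a m V) :
    Operator a (m * n) (K (m * n) ⊗[K m] V) :=
  let Ψ := TensorProduct.congr (shiftEquiv a m n) Φ
  { Ψ with
    map_smul' := fun f x => by
      change Ψ (f • x) = shift a (m * n) f • Ψ x
      induction x using TensorProduct.induction_on with
      | zero => simp
      | tmul g s =>
        rw [TensorProduct.smul_tmul', TensorProduct.congr_tmul, TensorProduct.congr_tmul,
          TensorProduct.smul_tmul', smul_eq_mul, smul_eq_mul]
        exact congrArg (· ⊗ₜ[K m] Φ s) (map_mul (shift a (m * n)) f g)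
      | add x z hx hz => rw [smul_add, map_add, hx, hz, map_add, smul_add] }

/-- `(V, Φ^*)` is pure isoclinic of slope `ω`: for every multiple `m₁ = m n` of `m` such that
`m₁ ω` is an integer `ℓ`, there is an `ℛ_{m₁}`-lattice `L` in `𝒦_{m₁} ⊗_{𝒦_m} V` such that
`y_{m₁} ^ ℓ Φ^*(L) = L`. -/
def IsPureIsoclinic {a : ℂ} {m : ℕ+} [Module (K m) V] (Φ : Operator a m V) (ω : ℚ) : Prop :=
  ∀ (n : ℕ+) (ℓ : ℤ), (ℓ : ℚ) = ((m * n : ℕ+) : ℕ) * ω →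
    ∃ L : Submodule ℂ⟦X⟧ (K (m * n) ⊗[K m] V), L.IsLattice (K (m * n)) ∧
      (fun x => y (m * n) ^ ℓ • pullback n Φ x) '' (L : Set (K (m * n) ⊗[K m] V)) = L

/-- A slope decomposition of `(V, Φ^*)`: a direct sum decomposition `V = ⨁_{ω ∈ ℚ} U ω` into
difference submodules such that `U ω` is pure isoclinic of slope `ω`. -/
structure IsSlopeDecomposition {a : ℂ} {m : ℕ+} [Module (K m) V] (Φ : Operator a m V)
    (U : ℚ → Submodule (K m) V) : Prop where
  isInternal : DirectSum.IsInternal U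
  map_eq : ∀ ω, (U ω).map (Φ : V →ₛₗ[shift a m] V) = U ω
  isPureIsoclinic : ∀ ω, IsPureIsoclinic (Φ.ofSubmodules (U ω) (U ω) (map_eq ω)) ω

end Modules

end QDiff

end

/-!
Every finite-dimensional difference module over `𝒦_m = ℂ((y_m))` is the direct sum of its slope
parts. The argument works with an arbitrary nonzero constant `c`, an operator `Φ` which is
semilinear for `f(y_m) ↦ f(c y_m)`, and the twisted powers `y_m ^ j Φ ^ n`; a set is called bounded
if it lies in a finitely generated `ℛ_m`-submodule.

For `λ ∈ ℚ`, let `V^{≥ λ}` (`IsDil.slopeGE`) consist of the `v` for which the `y_m ^ j Φ ^ n v` with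
`n ≥ 0` and `j ≥ -λ n` are bounded, and `V_λ` (`IsDil.slopePart`) of those for which this holds for
all `n ∈ ℤ`. No extension of `𝒦_m` is needed to define these subspaces, so that no descent is
needed later. With the normalisation of the definition of purity, `V_λ` has slope `ω` for
`λ = -m ω`.

*Independence.* `V_λ ∩ V^{≥ μ} = 0` for `λ < μ` (`IsDil.disjoint_slopePart_slopeGE`), as the bounded
span of the orbit of a vector in the intersection would be contained in all its multiples by powers
of `y_m`, up to a fixed factor.

*The least slope occurs.* For `v ≠ 0`, take a relation of minimal length
`Φ ^ (d + 1) v = ∑ a_i Φ ^ i v` and let `λ` be the minimum of `ord a_i / (d + 1 - i)`. Then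
`v ∈ V^{≥ λ}`, and the leading terms of the iterates of `Φ ^ d v` do not cancel, so that this vector
is not in `V^{≥ μ}` for any `μ > λ` (`IsDil.exists_newton_slope`). The minimum of these `λ` over a
basis gives a `λ` such that `V = V^{≥ λ}` but `V ≠ V^{≥ μ}` for all `μ > λ`.

*The least slope splits off.* If `V = V^{≥ λ}` with `λ = r / s`, there is a lattice `L` stable under
`F = y_m ^ (-r) Φ ^ s`. The complex vector spaces `L / y_m ^ k L` are finite-dimensional; their
Fitting decompositions for `F` converge to one of `L` (`exists_fitting`). On the nilpotent part `F`
gains a power of `y_m` after a number of steps that depends only on the number of generators of `L`,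
so that this part lies in `V^{≥ μ}` for some `μ > λ`, and the bijective part lies in `V_λ`. Hence
`V = V_λ + V^{≥ μ}` (`IsDil.exists_slopePart_sup_slopeGE_eq_top`), and induction on the dimension
gives `V = ∑ V_λ` (`IsDil.iSup_slopePart_eq_top`). Nothing here depends on `c`, which may be a root
of unity.

*Purity.* If `V = V_λ` with `λ = -m ω`, the `y_{mn} ^ j Φ ^ k (1 ⊗ v)` with `j ≥ m n ω k` are
bounded, and their span for `v` in a basis is the required lattice
(`isPureIsoclinic_of_slopePart_eq_top`).
-/

noncomputable section

namespace QDiff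

/-! ### Dilations of Laurent series and twisted powers -/

/-- The substitution `f(y_m) ↦ f(c y_m)` on `𝒦_m`, for an arbitrary nonzero constant `c`. -/
def dil (c : ℂˣ) (m : ℕ+) : K m →+* K m := dilate c

theorem dil_one (m : ℕ+) (f : K m) : dil 1 m f = f :=
  HahnSeries.ext (funext fun k => by
    change ((1 : ℂˣ) : ℂ) ^ k * HahnSeries.coeff (Γ := ℤ) (R := ℂ) f k = _
    simp)

theorem dil_dil (c d : ℂˣ) (m : ℕ+) (f : K m) : dil c m (dil d m f) = dil (c * d) m f :=
  HahnSeries.ext (funext fun k => by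
    change (c : ℂ) ^ k * ((d : ℂ) ^ k * HahnSeries.coeff (Γ := ℤ) (R := ℂ) f k) =
      ((c * d : ℂˣ) : ℂ) ^ k * HahnSeries.coeff (Γ := ℤ) (R := ℂ) f k
    rw [Units.val_mul, mul_zpow]; ring)

theorem y_ne_zero (m : ℕ+) : y m ≠ 0 :=
  HahnSeries.single_ne_zero (one_ne_zero)

theorem algebraMap_X (m : ℕ+) : algebraMap ℂ⟦X⟧ (K m) PowerSeries.X = y m :=
  PowerSeries.coe_X (R := ℂ)

theorem y_zpow (m : ℕ+) (j : ℤ) :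
    y m ^ j = (HahnSeries.single j (1 : ℂ) : LaurentSeries ℂ) := by
  exact (RatFunc.single_zpow (F := ℂ) j).symm

theorem dil_algebraMap (c : ℂˣ) (m : ℕ+) (r : ℂ⟦X⟧) :
    dil c m (algebraMap ℂ⟦X⟧ (K m) r) =
      algebraMap ℂ⟦X⟧ (K m) (PowerSeries.rescale (c : ℂ) r) := by
  refine HahnSeries.ext (funext fun k => ?_)
  change (c : ℂ) ^ k * ((r : ℂ⟦X⟧) : LaurentSeries ℂ).coeff k =
    ((PowerSeries.rescale (c : ℂ) r : ℂ⟦X⟧) : LaurentSeries ℂ).coeff k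
  rw [PowerSeries.coeff_coe, PowerSeries.coeff_coe]
  split_ifs with hk
  · simp
  · obtain ⟨n, rfl⟩ := Int.eq_ofNat_of_zero_le (not_lt.mp hk)
    simp [PowerSeries.coeff_rescale]

/-- The order of vanishing in `y_m`, with value `0` at `0`. -/
def ord {m : ℕ+} (f : K m) : ℤ := HahnSeries.order (Γ := ℤ) (R := ℂ) f

theorem exists_eq_y_zpow_ord_mul {m : ℕ+} (f : K m) :
    ∃ r : ℂ⟦X⟧, f = y m ^ ord f * algebraMap ℂ⟦X⟧ (K m) r := by
  refine ⟨LaurentSeries.powerSeriesPart f, ?_⟩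
  rw [y_zpow]
  exact (LaurentSeries.single_order_mul_powerSeriesPart (R := ℂ) f).symm

theorem dil_y_zpow (c : ℂˣ) (m : ℕ+) (j : ℤ) :
    dil c m (y m ^ j) =
      algebraMap ℂ⟦X⟧ (K m) (PowerSeries.C ((c ^ j : ℂˣ) : ℂ)) * y m ^ j := by
  have h : dil c m (y m) = algebraMap ℂ⟦X⟧ (K m) (PowerSeries.C (c : ℂ)) * y m := by
    rw [← algebraMap_X, dil_algebraMap, PowerSeries.rescale_X, map_mul]
  have hu : algebraMap ℂ⟦X⟧ (K m) (PowerSeries.C ((c ^ j : ℂˣ) : ℂ)) =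
      (algebraMap ℂ⟦X⟧ (K m) (PowerSeries.C (c : ℂ))) ^ j := by
    have := map_zpow (Units.map ((algebraMap ℂ⟦X⟧ (K m)).comp PowerSeries.C).toMonoidHom) c j
    have := congrArg Units.val this
    rw [Units.val_zpow_eq_zpow_val] at this
    exact this
  rw [map_zpow₀, h, mul_zpow, hu]

theorem rescale_C (a b : ℂ) : PowerSeries.rescale a (PowerSeries.C b) = PowerSeries.C b := by
  ext n
  rw [PowerSeries.coeff_rescale, PowerSeries.coeff_C]
  split_ifs with hn <;> simp [hn]

section Bounded

variable {R V W ι : Type*} [CommRing R] [AddCommGroup V] [Module R V] [AddCommGroup W] [Module R W]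

/-- A family of semilinear maps that is pointwise bounded is uniformly bounded on finitely
generated submodules. -/
theorem exists_fg_forall_mem_of_pointwise (t : ι → V →+ W) (τ : ι → R → R)
    (hτ : ∀ i r x, t i (r • x) = τ i r • t i x) {N : Submodule R V} (hN : N.FG)
    (h : ∀ x ∈ N, ∃ L : Submodule R W, L.FG ∧ ∀ i, t i x ∈ L) :
    ∃ L : Submodule R W, L.FG ∧ ∀ x ∈ N, ∀ i, t i x ∈ L := by
  obtain ⟨s, rfl⟩ := hN
  choose! L hL hLm using h
  refine ⟨s.sup L, Submodule.fg_finset_sup _ _ fun x hx => hL x (Submodule.subset_span hx),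
    fun x hx i => ?_⟩
  induction hx using Submodule.span_induction with
  | mem x hx => exact Finset.le_sup (f := L) hx (hLm x (Submodule.subset_span hx) i)
  | zero => rw [map_zero]; exact zero_mem _
  | add x z _ _ hx hz => rw [map_add]; exact add_mem hx hz
  | smul r x _ hx => rw [hτ]; exact Submodule.smul_mem _ _ hx

end Bounded

section Twist

variable {c : ℂˣ} {m : ℕ+} {V : Type*} [AddCommGroup V] [Module (K m) V]

/-- `Φ` is a `c`-difference operator: it is semilinear for `f(y_m) ↦ f(c y_m)`. -/
def IsDil (c : ℂˣ) (m : ℕ+) {V : Type*} [AddCommGroup V] [Module (K m) V] (Φ : V ≃ₗ[ℤ] V) :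
    Prop :=
  ∀ (f : K m) (v : V), Φ (f • v) = dil c m f • Φ v

theorem IsDil.mul {d : ℂˣ} {Φ Ψ : V ≃ₗ[ℤ] V} (hΦ : IsDil c m Φ) (hΨ : IsDil d m Ψ) :
    IsDil (c * d) m (Φ * Ψ) := fun f v => by
  rw [LinearEquiv.mul_apply, hΨ, hΦ, dil_dil, LinearEquiv.mul_apply]

theorem IsDil.inv {Φ : V ≃ₗ[ℤ] V} (hΦ : IsDil c m Φ) : IsDil c⁻¹ m Φ⁻¹ := fun f v => by
  apply Φ.injective
  have h (x : V) : Φ (Φ⁻¹ x) = x := Φ.apply_symm_apply x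
  rw [hΦ, h, h, dil_dil, mul_inv_cancel, dil_one]

theorem IsDil.pow {Φ : V ≃ₗ[ℤ] V} (hΦ : IsDil c m Φ) (n : ℕ) : IsDil (c ^ n) m (Φ ^ n) := by
  induction n with
  | zero => intro f v; simp [dil_one]
  | succ n ih => rw [pow_succ, pow_succ]; exact ih.mul hΦ

theorem IsDil.zpow {Φ : V ≃ₗ[ℤ] V} (hΦ : IsDil c m Φ) (n : ℤ) : IsDil (c ^ n) m (Φ ^ n) := by
  cases n with
  | ofNat n => simpa using hΦ.pow n
  | negSucc n => rw [zpow_negSucc, zpow_negSucc]; exact (hΦ.pow (n + 1)).inv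

/-- The twisted power `v ↦ y_m ^ j Φ ^ n v`. -/
def twist (m : ℕ+) {V : Type*} [AddCommGroup V] [Module (K m) V] (Φ : V ≃ₗ[ℤ] V) (j n : ℤ) :
    V →+ V :=
  (DistribSMul.toAddMonoidHom V (y m ^ j)).comp (Φ ^ n).toAddEquiv.toAddMonoidHom

theorem twist_apply (Φ : V ≃ₗ[ℤ] V) (j n : ℤ) (v : V) :
    twist m Φ j n v = y m ^ j • (Φ ^ n) v := rfl

theorem twist_zero_zero (Φ : V ≃ₗ[ℤ] V) (v : V) : twist m Φ 0 0 v = v := by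
  simp [twist_apply]

theorem IsDil.twist_smul {Φ : V ≃ₗ[ℤ] V} (hΦ : IsDil c m Φ) (j n : ℤ) (f : K m) (v : V) :
    twist m Φ j n (f • v) = dil (c ^ n) m f • twist m Φ j n v := by
  rw [twist_apply, hΦ.zpow, smul_comm, twist_apply]

theorem y_zpow_smul_twist (Φ : V ≃ₗ[ℤ] V) (k j n : ℤ) (v : V) :
    y m ^ k • twist m Φ j n v = twist m Φ (k + j) n v := by
  rw [twist_apply, twist_apply, smul_smul, ← zpow_add₀ (y_ne_zero m)]

variable [Module ℂ⟦X⟧ V] [IsScalarTower ℂ⟦X⟧ (K m) V]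

theorem IsDil.twist_twist {Φ : V ≃ₗ[ℤ] V} (hΦ : IsDil c m Φ) (j n j' n' : ℤ) (v : V) :
    twist m Φ j n (twist m Φ j' n' v) =
      PowerSeries.C (((c ^ n) ^ j' : ℂˣ) : ℂ) • twist m Φ (j + j') (n + n') v := by
  rw [twist_apply Φ j' n', hΦ.twist_smul, dil_y_zpow, mul_smul, algebraMap_smul, twist_apply,
    smul_smul, ← zpow_add₀ (y_ne_zero m), add_comm j', twist_apply, zpow_add Φ,
    LinearEquiv.mul_apply]

theorem C_smul_mem_iff {L : Submodule ℂ⟦X⟧ V} (u : ℂˣ) {v : V} :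
    PowerSeries.C (u : ℂ) • v ∈ L ↔ v ∈ L := by
  refine ⟨fun h => ?_, fun h => L.smul_mem _ h⟩
  have := L.smul_mem (PowerSeries.C ((u⁻¹ : ℂˣ) : ℂ)) h
  rwa [smul_smul, ← map_mul, ← Units.val_mul, inv_mul_cancel, Units.val_one, map_one, one_smul]
    at this

theorem IsDil.twist_twist_mem_iff {Φ : V ≃ₗ[ℤ] V} (hΦ : IsDil c m Φ) {L : Submodule ℂ⟦X⟧ V}
    (j n j' n' : ℤ) (v : V) :
    twist m Φ j n (twist m Φ j' n' v) ∈ L ↔ twist m Φ (j + j') (n + n') v ∈ L := by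
  rw [hΦ.twist_twist, C_smul_mem_iff]

theorem IsDil.twist_smul' {Φ : V ≃ₗ[ℤ] V} (hΦ : IsDil c m Φ) (j n : ℤ) (r : ℂ⟦X⟧) (v : V) :
    twist m Φ j n (r • v) =
      PowerSeries.rescale ((c ^ n : ℂˣ) : ℂ) r • twist m Φ j n v := by
  rw [← algebraMap_smul (K m) r, hΦ.twist_smul, dil_algebraMap, algebraMap_smul]

theorem y_pow_smul (k : ℕ) (v : V) : y m ^ (k : ℤ) • v = (PowerSeries.X ^ k : ℂ⟦X⟧) • v := by
  rw [← algebraMap_smul (K m) (PowerSeries.X ^ k : ℂ⟦X⟧), map_pow, algebraMap_X, zpow_natCast]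

theorem y_zpow_smul_mem {L : Submodule ℂ⟦X⟧ V} {k : ℤ} (hk : 0 ≤ k) {v : V} (hv : v ∈ L) :
    y m ^ k • v ∈ L := by
  obtain ⟨n, rfl⟩ := Int.eq_ofNat_of_zero_le hk
  rw [y_pow_smul]
  exact L.smul_mem _ hv

/-- A finitely generated `ℛ_m`-submodule is moved by a twisted power into another one. -/
theorem IsDil.exists_fg_twist_mem {Φ : V ≃ₗ[ℤ] V} (hΦ : IsDil c m Φ) (j n : ℤ)
    {L : Submodule ℂ⟦X⟧ V} (hL : L.FG) :
    ∃ L' : Submodule ℂ⟦X⟧ V, L'.FG ∧ ∀ x ∈ L, twist m Φ j n x ∈ L' := by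
  obtain ⟨L', h, h'⟩ := exists_fg_forall_mem_of_pointwise (fun _ : Unit => twist m Φ j n) _
    (fun _ => hΦ.twist_smul' j n) hL fun x _ => ⟨Submodule.span _ {twist m Φ j n x},
      Submodule.fg_span_singleton _, fun _ => Submodule.mem_span_singleton_self _⟩
  exact ⟨L', h, fun x hx => h' x hx ()⟩

theorem exists_fg_y_zpow_smul_mem (k : ℤ) {L : Submodule ℂ⟦X⟧ V} (hL : L.FG) :
    ∃ L' : Submodule ℂ⟦X⟧ V, L'.FG ∧ ∀ x ∈ L, y m ^ k • x ∈ L' := by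
  have h : IsDil 1 m (1 : V ≃ₗ[ℤ] V) := fun f v => by simp [dil_one]
  obtain ⟨L', h1, h2⟩ := h.exists_fg_twist_mem k 0 hL
  exact ⟨L', h1, fun x hx => by simpa [twist_apply] using h2 x hx⟩

end Twist

/-! ### Boundedness and slopes -/

section Bdd

variable {c : ℂˣ} {m : ℕ+} {V : Type*} [AddCommGroup V] [Module (K m) V]
  [Module ℂ⟦X⟧ V] [IsScalarTower ℂ⟦X⟧ (K m) V] {Φ : V ≃ₗ[ℤ] V}

/-- The subspace of those `v` for which the vectors `y_m ^ j Φ ^ n v` with `(j, n) ∈ A` all lie in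
one finitely generated `ℛ_m`-submodule. -/
def IsDil.bdd (hΦ : IsDil c m Φ) (A : Set (ℤ × ℤ)) : Submodule (K m) V where
  carrier := {v | ∃ L : Submodule ℂ⟦X⟧ V, L.FG ∧ ∀ p : A, twist m Φ p.1.1 p.1.2 v ∈ L}
  zero_mem' := ⟨⊥, Submodule.fg_bot, fun p => by simp⟩
  add_mem' := by
    rintro v w ⟨L, hL, hv⟩ ⟨M, hM, hw⟩
    refine ⟨L ⊔ M, hL.sup hM, fun p => ?_⟩
    rw [map_add]
    exact add_mem (Submodule.mem_sup_left (hv p)) (Submodule.mem_sup_right (hw p))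
  smul_mem' := by
    rintro f v ⟨L, hL, hv⟩
    obtain ⟨r, hr⟩ := exists_eq_y_zpow_ord_mul f
    obtain ⟨L', hL', hLm⟩ := exists_fg_y_zpow_smul_mem (m := m) (ord f) hL
    refine ⟨L', hL', fun p => ?_⟩
    rw [hr, hΦ.twist_smul, map_mul, dil_y_zpow, dil_algebraMap, mul_assoc, mul_smul, mul_smul,
      algebraMap_smul, algebraMap_smul]
    exact L'.smul_mem _ (hLm _ (L.smul_mem _ (hv p)))

variable (hΦ : IsDil c m Φ)

theorem IsDil.bdd_anti {A B : Set (ℤ × ℤ)} (h : A ⊆ B) : hΦ.bdd B ≤ hΦ.bdd A :=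
  fun _ ⟨L, hL, hv⟩ => ⟨L, hL, fun p => hv ⟨p, h p.2⟩⟩

theorem IsDil.twist_mem_bdd {A : Set (ℤ × ℤ)} (j n : ℤ) {v : V} (hv : v ∈ hΦ.bdd A) :
    twist m Φ j n v ∈ hΦ.bdd A := by
  obtain ⟨L, hL, hv⟩ := hv
  obtain ⟨L', hL', h⟩ := hΦ.exists_fg_twist_mem j n hL
  refine ⟨L', hL', fun p => ?_⟩
  rw [hΦ.twist_twist_mem_iff, add_comm, add_comm _ n, ← hΦ.twist_twist_mem_iff]
  exact h _ (hv p)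

theorem IsDil.exists_fg_of_le_bdd {A : Set (ℤ × ℤ)} {N : Submodule ℂ⟦X⟧ V} (hN : N.FG)
    (h : ∀ x ∈ N, x ∈ hΦ.bdd A) :
    ∃ L : Submodule ℂ⟦X⟧ V, L.FG ∧ ∀ x ∈ N, ∀ p : A, twist m Φ p.1.1 p.1.2 x ∈ L :=
  exists_fg_forall_mem_of_pointwise (fun p : A => twist m Φ p.1.1 p.1.2) _
    (fun p => hΦ.twist_smul' p.1.1 p.1.2) hN h

/-- A vector all of whose multiples by negative powers of `y_m` are in a finitely generated
`ℛ_m`-submodule vanishes. -/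
theorem eq_zero_of_forall_y_zpow_smul_mem {L : Submodule ℂ⟦X⟧ V} (hL : L.FG) {x : V}
    (h : ∀ k : ℕ, y m ^ (-(k : ℤ)) • x ∈ L) : x = 0 := by
  let N : Submodule ℂ⟦X⟧ V := Submodule.span _ (Set.range fun k : ℕ => y m ^ (-(k : ℤ)) • x)
  have hNL : N ≤ L := Submodule.span_le.mpr (by rintro _ ⟨k, rfl⟩; exact h k)
  have hle : N ≤ Ideal.span {(PowerSeries.X : ℂ⟦X⟧)} • N := by
    refine Submodule.span_le.mpr ?_
    rintro _ ⟨k, rfl⟩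
    have hk : y m ^ (-((k + 1 : ℕ) : ℤ)) • x ∈ N := Submodule.subset_span ⟨k + 1, rfl⟩
    have := Submodule.smul_mem_smul
      (Ideal.mem_span_singleton_self (PowerSeries.X : ℂ⟦X⟧)) hk
    have h1 := y_pow_smul (m := m) 1 (y m ^ (-((k + 1 : ℕ) : ℤ)) • x)
    rw [pow_one] at h1
    rw [← h1, smul_smul, ← zpow_add₀ (y_ne_zero m)] at this
    rwa [show ((1 : ℕ) : ℤ) + -((k + 1 : ℕ) : ℤ) = -(k : ℤ) by push_cast; ring] at this
  have hbot := Submodule.eq_bot_of_le_smul_of_le_jacobson_bot _ N (hL.of_le hNL) hle (by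
    rw [IsLocalRing.jacobson_eq_maximalIdeal ⊥ bot_ne_top, Ideal.span_le,
      Set.singleton_subset_iff]
    simp [IsLocalRing.mem_maximalIdeal, PowerSeries.isUnit_iff_constantCoeff])
  have hx : x ∈ N := Submodule.subset_span ⟨0, by simp⟩
  rwa [hbot, Submodule.mem_bot] at hx

/-- The exponents of the twisted powers `y_m ^ j Φ ^ n` with `n ≥ 0` and `j ≥ -λ n`. -/
def slopeCone (lam : ℚ) : Set (ℤ × ℤ) := {p | 0 ≤ p.2 ∧ 0 ≤ (p.1 : ℚ) + lam * p.2}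

/-- The exponents of the twisted powers `y_m ^ j Φ ^ n` with `j ≥ -λ n`. -/
def slopeHalfPlane (lam : ℚ) : Set (ℤ × ℤ) := {p | 0 ≤ (p.1 : ℚ) + lam * p.2}

theorem slopeCone_mono {lam mu : ℚ} (h : lam ≤ mu) : slopeCone lam ⊆ slopeCone mu :=
  fun p ⟨h1, h2⟩ => ⟨h1, h2.trans (by
    have : (0 : ℚ) ≤ p.2 := by exact_mod_cast h1
    gcongr)⟩

theorem zero_mem_slopeCone (lam : ℚ) : 0 ∈ slopeCone lam := by simp [slopeCone]

theorem add_mem_slopeCone {lam : ℚ} {p q : ℤ × ℤ} (hp : p ∈ slopeCone lam)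
    (hq : q ∈ slopeCone lam) : p + q ∈ slopeCone lam := by
  refine ⟨add_nonneg hp.1 hq.1, ?_⟩
  have := add_nonneg hp.2 hq.2
  push_cast [Prod.fst_add, Prod.snd_add]
  linarith

theorem zero_mem_slopeHalfPlane (lam : ℚ) : 0 ∈ slopeHalfPlane lam := by simp [slopeHalfPlane]

theorem add_mem_slopeHalfPlane {lam : ℚ} {p q : ℤ × ℤ} (hp : p ∈ slopeHalfPlane lam)
    (hq : q ∈ slopeHalfPlane lam) : p + q ∈ slopeHalfPlane lam := by
  have := add_nonneg (α := ℚ) hp hq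
  change (0 : ℚ) ≤ _
  push_cast [Prod.fst_add, Prod.snd_add]
  linarith

theorem slopeCone_subset (lam : ℚ) : slopeCone lam ⊆ slopeHalfPlane lam := fun _ h => h.2

/-- `Φ ^ n` grows at least as fast as `y_m ^ (λ n)` on this subspace: the part of slope `≥ λ`. -/
def IsDil.slopeGE (hΦ : IsDil c m Φ) (lam : ℚ) : Submodule (K m) V := hΦ.bdd (slopeCone lam)

/-- `Φ ^ n` behaves as `y_m ^ (λ n)` on this subspace, in both directions: the part of
slope `λ`. -/
def IsDil.slopePart (hΦ : IsDil c m Φ) (lam : ℚ) : Submodule (K m) V :=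
  hΦ.bdd (slopeHalfPlane lam)

theorem IsDil.slopeGE_anti {lam mu : ℚ} (h : lam ≤ mu) : hΦ.slopeGE mu ≤ hΦ.slopeGE lam :=
  hΦ.bdd_anti (slopeCone_mono h)

theorem IsDil.slopePart_le_slopeGE (lam : ℚ) : hΦ.slopePart lam ≤ hΦ.slopeGE lam :=
  hΦ.bdd_anti (slopeCone_subset lam)

/-- Given `v` in both parts, the finitely generated span `N` of the `y_m ^ j Φ ^ n v` with
`j ≥ -λ n` is contained in `y_m ^ k N` up to a fixed bounded factor, for all `k`: apply the bounds
for the larger slope `μ` to `N`, for a twisted power close to the line `j = -λ n`. -/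
theorem IsDil.disjoint_slopePart_slopeGE {lam mu : ℚ} (h : lam < mu) :
    Disjoint (hΦ.slopePart lam) (hΦ.slopeGE mu) := by
  rw [Submodule.disjoint_def]
  rintro v ⟨L, hL, hv⟩ hv'
  let N : Submodule ℂ⟦X⟧ V :=
    Submodule.span _ (Set.range fun p : slopeHalfPlane lam => twist m Φ p.1.1 p.1.2 v)
  have hNL : N ≤ L := Submodule.span_le.mpr (by rintro _ ⟨p, rfl⟩; exact hv p)
  have hN : ∀ x ∈ N, x ∈ hΦ.slopeGE mu := by
    intro x hx
    have : N ≤ (hΦ.slopeGE mu).restrictScalars ℂ⟦X⟧ :=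
      Submodule.span_le.mpr (by rintro _ ⟨p, rfl⟩; exact hΦ.twist_mem_bdd _ _ hv')
    exact this hx
  obtain ⟨M, hM, hNM⟩ := hΦ.exists_fg_of_le_bdd (hL.of_le hNL) hN
  refine eq_zero_of_forall_y_zpow_smul_mem (m := m) hM fun k => ?_
  obtain ⟨n, hn⟩ := exists_nat_ge (((k : ℚ) + 1) / (mu - lam))
  rw [div_le_iff₀ (sub_pos.mpr h)] at hn
  -- the largest `j` with `j + λ n ≤ 0`
  let j : ℤ := ⌊-(lam * n)⌋
  have hj : (j : ℚ) ≤ -(lam * n) := Int.floor_le _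
  have hj' : -(lam * n) - 1 < (j : ℚ) := Int.sub_one_lt_floor _
  have hmem : twist m Φ (-j) (-n) v ∈ N :=
    Submodule.subset_span ⟨⟨(-j, -n), by
      change (0 : ℚ) ≤ ((-j : ℤ) : ℚ) + lam * ((-n : ℤ) : ℚ)
      push_cast; linarith⟩, rfl⟩
  have := hNM _ hmem ⟨(j - k, n), by
      refine ⟨Int.natCast_nonneg n, ?_⟩
      push_cast; linarith⟩
  rw [hΦ.twist_twist_mem_iff] at this
  rw [show j - k + -j = -(k : ℤ) + 0 by ring, add_neg_cancel, ← y_zpow_smul_twist,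
    twist_zero_zero] at this
  exact this

theorem IsDil.iSupIndep_slopePart : iSupIndep hΦ.slopePart := by
  rw [iSupIndep_iff_finsetSum_eq_zero_imp_eq_zero]
  intro s v
  induction s using Finset.induction_on_min with
  | empty => simp
  | insert lam s hlt ih =>
    intro hv hsum
    have hnot : lam ∉ s := fun h => lt_irrefl _ (hlt lam h)
    rw [Finset.sum_insert hnot] at hsum
    have h0 : v lam = 0 := by
      rcases s.eq_empty_or_nonempty with rfl | hs
      · simpa using hsum
      · refine Submodule.disjoint_def.mp
          (hΦ.disjoint_slopePart_slopeGE (hlt _ (s.min'_mem hs))) _ (hv _ (by simp)) ?_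
        rw [eq_neg_of_add_eq_zero_left hsum]
        refine neg_mem (sum_mem fun i hi => ?_)
        exact hΦ.slopeGE_anti (s.min'_le i hi)
          (hΦ.slopePart_le_slopeGE i (hv i (Finset.mem_insert_of_mem hi)))
    rw [h0, zero_add] at hsum
    have := ih (fun i hi => hv i (Finset.mem_insert_of_mem hi)) hsum
    simpa [h0] using this

end Bdd

/-! ### Fitting decomposition over the ring of power series -/

section Fitting

variable {M : Type*} [AddCommGroup M] [Module ℂ⟦X⟧ M]

/-- Submodules of a finitely generated module over `ℂ⟦X⟧` are closed. -/
theorem mem_of_forall_sub_X_pow_smul_mem [Module.Finite ℂ⟦X⟧ M] {N : Submodule ℂ⟦X⟧ M} {x : M}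
    (h : ∀ k : ℕ, ∃ z, x - (PowerSeries.X ^ k : ℂ⟦X⟧) • z ∈ N) : x ∈ N := by
  have hI : Ideal.span {(PowerSeries.X : ℂ⟦X⟧)} ≠ ⊤ := by
    rw [← PowerSeries.maximalIdeal_eq_span_X]
    exact Ideal.IsPrime.ne_top'
  have := IsHausdorff.of_isLocalRing _ (M ⧸ N) hI
  rw [← Submodule.Quotient.mk_eq_zero]
  refine this.haus _ fun k => ?_
  obtain ⟨z, hz⟩ := h k
  rw [SModEq.sub_mem, sub_zero, (Submodule.Quotient.eq N).mpr hz, Submodule.Quotient.mk_smul]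
  exact Submodule.smul_mem_smul (Ideal.pow_mem_pow (Ideal.mem_span_singleton_self _) k)
    Submodule.mem_top

/-- A finitely generated module over `ℂ⟦X⟧` is complete. -/
theorem exists_limit_of_span_eq_top {ι : Type*} [Fintype ι] {g : ι → M}
    (hg : Submodule.span ℂ⟦X⟧ (Set.range g) = ⊤) (a : ℕ → M)
    (ha : ∀ k, ∃ z, a (k + 1) - a k = (PowerSeries.X ^ k : ℂ⟦X⟧) • z) :
    ∃ b, ∀ k, ∃ z, b - a k = (PowerSeries.X ^ k : ℂ⟦X⟧) • z := by
  have hrep (z : M) : ∃ r : ι → ℂ⟦X⟧, ∑ i, r i • g i = z :=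
    (Submodule.mem_span_range_iff_exists_fun _).mp (hg ▸ Submodule.mem_top)
  choose z hz using ha
  choose r hr using fun k => hrep (z k)
  let p (i : ι) (k : ℕ) : ℂ⟦X⟧ := ∑ l ∈ Finset.range k, PowerSeries.X ^ l * r l i
  have hp (i : ι) : ∃ s : ℂ⟦X⟧, ∀ k, ∃ t, s - p i k = PowerSeries.X ^ k * t := by
    obtain ⟨s, hs⟩ := IsPrecomplete.prec (I := Ideal.span {(PowerSeries.X : ℂ⟦X⟧)})
      (M := ℂ⟦X⟧) inferInstance (f := p i) (by
        intro k l hkl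
        rw [SModEq.sub_mem, ← neg_sub, Submodule.neg_mem_iff, smul_eq_mul, Ideal.mul_top,
          Ideal.span_singleton_pow, Ideal.mem_span_singleton, Finset.sum_range_sub_sum_range hkl]
        refine Finset.dvd_sum fun j hj => Dvd.dvd.mul_right (pow_dvd_pow _ ?_) _
        simp only [Finset.mem_filter] at hj
        exact hj.2)
    refine ⟨s, fun k => ?_⟩
    have := (hs k).symm
    rw [SModEq.sub_mem, smul_eq_mul, Ideal.mul_top, Ideal.span_singleton_pow,
      Ideal.mem_span_singleton] at this
    exact this
  choose s hs using hp
  choose t ht using hs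
  have hak (k : ℕ) : a k = a 0 + ∑ i, p i k • g i := by
    induction k with
    | zero => simp [p]
    | succ k ih =>
      rw [← sub_add_cancel (a (k + 1)) (a k), hz, ← hr, ih, Finset.smul_sum, add_left_comm,
        ← Finset.sum_add_distrib]
      simp only [p, Finset.sum_range_succ, add_smul, mul_smul]
      congr 1
      exact Finset.sum_congr rfl fun i _ => add_comm _ _
  refine ⟨a 0 + ∑ i, s i • g i, fun k => ⟨∑ i, t i k • g i, ?_⟩⟩
  rw [hak k, add_sub_add_left_eq_sub, ← Finset.sum_sub_distrib, Finset.smul_sum]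
  exact Finset.sum_congr rfl fun i _ => by rw [← sub_smul, ht, mul_smul]

variable [Module ℂ M] [IsScalarTower ℂ ℂ⟦X⟧ M]

/-- The complex vector space `M / X ^ k M` is spanned by the `X ^ j g_i` with `j < k`. -/
theorem exists_eq_sum_X_pow_smul_add {ι : Type*} [Fintype ι] {g : ι → M}
    (hg : Submodule.span ℂ⟦X⟧ (Set.range g) = ⊤) (k : ℕ) (x : M) :
    ∃ (u : ι × Fin k → ℂ) (z : M),
      x = ∑ p, u p • (PowerSeries.X ^ (p.2 : ℕ) : ℂ⟦X⟧) • g p.1 +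
        (PowerSeries.X ^ k : ℂ⟦X⟧) • z := by
  obtain ⟨r, rfl⟩ : ∃ r : ι → ℂ⟦X⟧, ∑ i, r i • g i = x :=
    (Submodule.mem_span_range_iff_exists_fun _).mp (hg ▸ Submodule.mem_top)
  have h (f : ℂ⟦X⟧) : ∃ t : ℂ⟦X⟧,
      f = ∑ j : Fin k, f.coeff j • PowerSeries.X ^ (j : ℕ) + PowerSeries.X ^ k * t := by
    obtain ⟨t, ht⟩ := (PowerSeries.X_pow_dvd_iff (n := k)
      (φ := f - ∑ j : Fin k, f.coeff j • PowerSeries.X ^ (j : ℕ))).mpr fun n hn => by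
        rw [map_sub, map_sum, Finset.sum_eq_single ⟨n, hn⟩]
        · simp
        · intro j _ hj
          have : n ≠ j := fun h => hj (Fin.ext h.symm)
          simp [PowerSeries.coeff_X_pow, this]
        · simp
    exact ⟨t, by rw [← ht]; ring⟩
  choose t ht using fun i => h (r i)
  refine ⟨fun p => (r p.1).coeff p.2, ∑ i, t i • g i, ?_⟩
  rw [Fintype.sum_prod_type, Finset.smul_sum, ← Finset.sum_add_distrib]
  refine Finset.sum_congr rfl fun i _ => ?_
  conv_lhs => rw [ht i]
  rw [add_smul, Finset.sum_smul, mul_smul]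
  simp only [smul_assoc]

/-- The Fitting decomposition of the complex vector space `M / X ^ k M`, in terms of
representatives: the existence of the nilpotent component `a` of `x`, and its uniqueness. -/
theorem exists_fitting_mod_X_pow {d k : ℕ} {g : Fin d → M}
    (hg : Submodule.span ℂ⟦X⟧ (Set.range g) = ⊤) (f : M →ₗ[ℂ] M)
    (P : Submodule ℂ M) (hP : ∀ x, x ∈ P ↔ ∃ z : M, x = (PowerSeries.X ^ k : ℂ⟦X⟧) • z)
    (hf : P ≤ P.comap f) :
    (∀ x, ∃ a, (f ^ (d * k)) a ∈ P ∧ ∀ n, ∃ z, x - a - (f ^ n) z ∈ P) ∧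
    ∀ a, (∃ n, (f ^ n) a ∈ P) → (∀ n, ∃ z, a - (f ^ n) z ∈ P) → a ∈ P := by
  have hP0 (x : M) : P.mkQ x = 0 ↔ x ∈ P := Submodule.Quotient.mk_eq_zero P
  let φ : Module.End ℂ (M ⧸ P) := P.mapQ P f hf
  have hφ (n : ℕ) (x : M) : (φ ^ n) (P.mkQ x) = P.mkQ ((f ^ n) x) := by
    induction n generalizing x with
    | zero => rfl
    | succ n ih => rw [pow_succ, pow_succ, Module.End.mul_apply, Module.End.mul_apply, ← ih]; rfl
  have hspan : Submodule.span ℂ (Set.range fun p : Fin d × Fin k =>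
      P.mkQ ((PowerSeries.X ^ (p.2 : ℕ) : ℂ⟦X⟧) • g p.1)) = ⊤ := by
    rw [eq_top_iff]
    rintro x -
    obtain ⟨x, rfl⟩ := P.mkQ_surjective x
    obtain ⟨u, z, rfl⟩ := exists_eq_sum_X_pow_smul_add hg k x
    rw [map_add, (hP0 _).mpr ((hP _).mpr ⟨z, rfl⟩), add_zero, map_sum]
    refine sum_mem fun p _ => ?_
    rw [map_smul]
    exact Submodule.smul_mem _ _ (Submodule.subset_span ⟨p, rfl⟩)
  have hfin : FiniteDimensional ℂ (M ⧸ P) :=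
    Module.finite_def.mpr (hspan ▸ Submodule.fg_span (Set.finite_range _))
  have hrank : Module.finrank ℂ (M ⧸ P) ≤ d * k := by
    have := finrank_range_le_card (R := ℂ) (fun p : Fin d × Fin k =>
      P.mkQ ((PowerSeries.X ^ (p.2 : ℕ) : ℂ⟦X⟧) • g p.1))
    rw [Set.finrank, hspan, finrank_top] at this
    simpa using this
  have hker : ⨆ n, LinearMap.ker (φ ^ n) = LinearMap.ker (φ ^ (d * k)) :=
    le_antisymm (iSup_le fun n => (Module.End.ker_pow_le_ker_pow_finrank φ n).trans_eq
      (Module.End.ker_pow_eq_ker_pow_finrank_of_le hrank).symm)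
      (le_iSup (fun n => LinearMap.ker (φ ^ n)) (d * k))
  have hcompl := LinearMap.isCompl_iSup_ker_pow_iInf_range_pow φ
  have hrange (n : ℕ) (x : M) : P.mkQ x ∈ LinearMap.range (φ ^ n) ↔ ∃ z, x - (f ^ n) z ∈ P := by
    constructor
    · rintro ⟨z, hz⟩
      obtain ⟨z, rfl⟩ := P.mkQ_surjective z
      rw [hφ] at hz
      exact ⟨z, (Submodule.Quotient.eq P).mp hz.symm⟩
    · rintro ⟨z, hz⟩
      exact ⟨P.mkQ z, by rw [hφ]; exact ((Submodule.Quotient.eq P).mpr hz).symm⟩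
  constructor
  · intro x
    obtain ⟨α, hα, β, hβ, hαβ⟩ := Submodule.mem_sup.mp
      (hcompl.sup_eq_top ▸ Submodule.mem_top : P.mkQ x ∈ _)
    obtain ⟨a, rfl⟩ := P.mkQ_surjective α
    rw [hker, LinearMap.mem_ker, hφ, hP0] at hα
    refine ⟨a, hα, fun n => (hrange n _).mp ?_⟩
    rw [map_sub, ← hαβ, add_sub_cancel_left]
    exact (Submodule.mem_iInf _).mp hβ n
  · rintro a ⟨n, hn⟩ ha
    rw [← hP0]
    refine Submodule.disjoint_def.mp hcompl.disjoint _
      (Submodule.mem_iSup_of_mem n ?_) ((Submodule.mem_iInf _).mpr fun n => (hrange n a).mpr (ha n))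
    rwa [LinearMap.mem_ker, hφ, hP0]

/-- The Fitting decomposition of a finitely generated module over `ℂ⟦X⟧` with respect to a
semilinear endomorphism: every `x` is the sum of a vector `a` on which `f` is topologically
nilpotent and a vector which is in the image of all powers of `f`. The nilpotency is uniform,
because `f ^ (d k)` annihilates the nilpotent part of `M / X ^ k M`, of dimension at most `d k`. -/
theorem exists_fitting {d : ℕ} {g : Fin d → M}
    (hg : Submodule.span ℂ⟦X⟧ (Set.range g) = ⊤) (f : M →ₗ[ℂ] M) (u : ℂˣ)
    (hf : ∀ (r : ℂ⟦X⟧) x, f (r • x) = PowerSeries.rescale (u : ℂ) r • f x) (x : M) :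
    ∃ a, (∀ k, ∃ z, (f ^ (d * k)) a = (PowerSeries.X ^ k : ℂ⟦X⟧) • z) ∧
      ∀ n, ∃ z, x - a = (f ^ n) z := by
  have hfin : Module.Finite ℂ⟦X⟧ M :=
    Module.finite_def.mpr (hg ▸ Submodule.fg_span (Set.finite_range _))
  have hfn (n : ℕ) (r : ℂ⟦X⟧) (x : M) :
      (f ^ n) (r • x) = PowerSeries.rescale ((u ^ n : ℂˣ) : ℂ) r • (f ^ n) x := by
    induction n with
    | zero => simp
    | succ n ih =>
      rw [pow_succ', Module.End.mul_apply, ih, hf, PowerSeries.rescale_rescale,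
        Module.End.mul_apply, pow_succ, Units.val_mul]
  let P (k : ℕ) : Submodule ℂ M :=
    LinearMap.range ((LinearMap.lsmul ℂ⟦X⟧ M (PowerSeries.X ^ k)).restrictScalars ℂ)
  have hP (k : ℕ) (x : M) : x ∈ P k ↔ ∃ z : M, x = (PowerSeries.X ^ k : ℂ⟦X⟧) • z :=
    exists_congr fun z => eq_comm
  have hPn (k n : ℕ) {x : M} (hx : x ∈ P k) : (f ^ n) x ∈ P k := by
    obtain ⟨z, rfl⟩ := (hP k x).mp hx
    exact (hP k _).mpr ⟨_, by rw [hfn, map_pow, PowerSeries.rescale_X, mul_pow, mul_comm,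
      mul_smul]⟩
  have hPf (k : ℕ) : P k ≤ (P k).comap f := fun x hx => by simpa using hPn k 1 hx
  have hPanti {k l : ℕ} (h : k ≤ l) : P l ≤ P k := by
    intro x hx
    obtain ⟨z, rfl⟩ := (hP l x).mp hx
    exact (hP k _).mpr ⟨(PowerSeries.X ^ (l - k) : ℂ⟦X⟧) • z, by
      rw [smul_smul, ← pow_add, Nat.add_sub_cancel' h]⟩
  have hfit (k : ℕ) := exists_fitting_mod_X_pow hg f (P k) (hP k) (hPf k)
  choose a ha hb using fun k => (hfit k).1 x
  have hlim (k : ℕ) : a (k + 1) - a k ∈ P k := by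
    refine (hfit k).2 _ ⟨d * (k + 1), ?_⟩ fun n => ?_
    · rw [map_sub]
      refine sub_mem (hPanti k.le_succ (ha _)) ?_
      rw [mul_add, add_comm, pow_add, Module.End.mul_apply]
      exact hPn k _ (ha k)
    · obtain ⟨z, hz⟩ := hb (k + 1) n
      obtain ⟨z', hz'⟩ := hb k n
      refine ⟨z' - z, ?_⟩
      convert sub_mem hz' (hPanti k.le_succ hz) using 1
      rw [map_sub]; abel
  obtain ⟨b, hba⟩ := exists_limit_of_span_eq_top hg a fun k => (hP k _).mp (hlim k)
  refine ⟨b, fun k => (hP k _).mp ?_, fun n => ?_⟩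
  · rw [← sub_add_cancel b (a k), map_add]
    exact add_mem (hPn k _ ((hP k _).mpr (hba k))) (ha k)
  · let N : Submodule ℂ⟦X⟧ M :=
      { carrier := Set.range (f ^ n)
        zero_mem' := ⟨0, map_zero _⟩
        add_mem' := by rintro _ _ ⟨z, rfl⟩ ⟨z', rfl⟩; exact ⟨z + z', map_add _ _ _⟩
        smul_mem' := by
          rintro r _ ⟨z, rfl⟩
          refine ⟨PowerSeries.rescale (((u ^ n)⁻¹ : ℂˣ) : ℂ) r • z, ?_⟩
          rw [hfn, PowerSeries.rescale_rescale, ← Units.val_mul, inv_mul_cancel, Units.val_one,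
            PowerSeries.rescale_one, RingHom.id_apply] }
    have : x - b ∈ N := mem_of_forall_sub_X_pow_smul_mem fun k => by
      obtain ⟨z, hz⟩ := hb k n
      obtain ⟨w, hw⟩ := (hP k _).mp hz
      obtain ⟨w', hw'⟩ := hba k
      refine ⟨w - w', z, ?_⟩
      rw [smul_sub, ← hw, ← hw']
      abel
    obtain ⟨z, hz⟩ := this
    exact ⟨z, hz.symm⟩

end Fitting

/-! ### Splitting off the least slope -/

section Split

variable {c : ℂˣ} {m : ℕ+} {V : Type*} [AddCommGroup V] [Module (K m) V]
  [Module ℂ⟦X⟧ V] [IsScalarTower ℂ⟦X⟧ (K m) V] {Φ : V ≃ₗ[ℤ] V} (hΦ : IsDil c m Φ)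

/-- If the orbits of all vectors under the twisted powers with exponents in the submonoid `A` are
bounded, every finitely generated `ℛ_m`-submodule is contained in one that is stable under these
twisted powers. -/
theorem IsDil.exists_stable_of_bdd_eq_top {A : Set (ℤ × ℤ)} (h0 : 0 ∈ A)
    (hadd : ∀ p ∈ A, ∀ q ∈ A, p + q ∈ A) (h : hΦ.bdd A = ⊤)
    {N : Submodule ℂ⟦X⟧ V} (hN : N.FG) :
    ∃ L : Submodule ℂ⟦X⟧ V, L.FG ∧ N ≤ L ∧
      ∀ j n : ℤ, (j, n) ∈ A → ∀ x ∈ L, twist m Φ j n x ∈ L := by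
  obtain ⟨L₀, hL₀, hm⟩ := hΦ.exists_fg_of_le_bdd hN (A := A)
    fun x _ => (h ▸ Submodule.mem_top : x ∈ hΦ.bdd A)
  let L : Submodule ℂ⟦X⟧ V := Submodule.span _
    {x | ∃ z ∈ N, ∃ p ∈ A, twist m Φ p.1 p.2 z = x}
  have hL : L ≤ L₀ := Submodule.span_le.mpr (by rintro _ ⟨z, hz, p, hp, rfl⟩; exact hm z hz ⟨p, hp⟩)
  refine ⟨L, hL₀.of_le hL, fun x hx => Submodule.subset_span ⟨x, hx, 0, h0, ?_⟩, ?_⟩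
  · exact twist_zero_zero Φ x
  · intro j n hjn x hx
    induction hx using Submodule.span_induction with
    | mem x hx =>
      obtain ⟨z, hz, p, hp, rfl⟩ := hx
      rw [hΦ.twist_twist_mem_iff]
      refine Submodule.subset_span ⟨z, hz, (j, n) + p, hadd _ hjn _ hp, rfl⟩
    | zero => rw [map_zero]; exact zero_mem _
    | add x z _ _ hx hz => rw [map_add]; exact add_mem hx hz
    | smul r x _ hx => rw [hΦ.twist_smul']; exact L.smul_mem _ hx

/-- If `V` is of slopes `≥ λ = r / s`, the part of slope `λ` splits off: it is the bijective part,
and the part of slopes `> λ` the nilpotent part, of the Fitting decomposition of a stable lattice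
for `y_m ^ (-r) Φ ^ s`. -/
theorem IsDil.exists_slopePart_sup_slopeGE_eq_top [FiniteDimensional (K m) V] {lam : ℚ}
    (h : hΦ.slopeGE lam = ⊤) :
    ∃ mu > lam, hΦ.slopePart lam ⊔ hΦ.slopeGE mu = ⊤ := by
  let b := Module.finBasis (K m) V
  obtain ⟨L, hL, hbL, hst⟩ := hΦ.exists_stable_of_bdd_eq_top (zero_mem_slopeCone lam)
    (fun _ hp _ hq => add_mem_slopeCone hp hq) h
    (Submodule.fg_span (R := ℂ⟦X⟧) (Set.finite_range b))
  have hLfin : Module.Finite ℂ⟦X⟧ L := Module.Finite.iff_fg.mpr hL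
  obtain ⟨d, g, hg⟩ := Module.Finite.exists_fin (R := ℂ⟦X⟧) (M := L)
  -- an additional zero generator makes the number of generators positive
  have hg' : Submodule.span ℂ⟦X⟧ (Set.range (Fin.cons 0 g : Fin (d + 1) → L)) = ⊤ := by
    rw [Fin.range_cons, Submodule.span_insert_zero, hg]
  have hs : (0 : ℚ) < lam.den := by exact_mod_cast lam.pos
  have hlam : (lam.num : ℚ) = lam * lam.den := (Rat.mul_den_eq_num lam).symm
  have hF : (-lam.num, (lam.den : ℤ)) ∈ slopeCone lam :=
    ⟨Int.natCast_nonneg _, by push_cast; linarith⟩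
  let : Module ℂ L := Module.compHom L (PowerSeries.C : ℂ →+* ℂ⟦X⟧)
  have hC (u : ℂ) (x : L) : u • x = (PowerSeries.C u : ℂ⟦X⟧) • x := rfl
  have : IsScalarTower ℂ ℂ⟦X⟧ L := ⟨fun u r x => by
    rw [hC, PowerSeries.smul_eq_C_mul, mul_smul]⟩
  have hfsmul (r : ℂ⟦X⟧) (x : L) : (⟨_, hst _ _ hF _ (r • x).2⟩ : L) =
      PowerSeries.rescale ((c ^ (lam.den : ℤ) : ℂˣ) : ℂ) r • (⟨_, hst _ _ hF _ x.2⟩ : L) :=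
    Subtype.ext (hΦ.twist_smul' _ _ r (x : V))
  let f : L →ₗ[ℂ] L :=
    { toFun := fun x => ⟨_, hst _ _ hF _ x.2⟩
      map_add' := fun x z => Subtype.ext (map_add _ _ _)
      map_smul' := fun u x => by
        refine (hfsmul (PowerSeries.C u) x).trans ?_
        rw [RingHom.id_apply, hC, rescale_C] }
  have hpow (N : ℕ) (x : L) : ∃ u : ℂˣ, (((f ^ N) x : L) : V) =
      PowerSeries.C (u : ℂ) • twist m Φ (-lam.num * N) (lam.den * N) (x : V) := by
    induction N with
    | zero => exact ⟨1, by simp [twist_zero_zero]⟩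
    | succ N ih =>
      obtain ⟨u, hu⟩ := ih
      refine ⟨u * (c ^ (lam.den : ℤ)) ^ (-lam.num * N), ?_⟩
      have : (((f ^ (N + 1)) x : L) : V) =
          twist m Φ (-lam.num) lam.den (((f ^ N) x : L) : V) := by
        rw [pow_succ', Module.End.mul_apply]; rfl
      rw [this, hu, hΦ.twist_smul', rescale_C, hΦ.twist_twist, smul_smul, ← map_mul,
        ← Units.val_mul]
      congr 3 <;> push_cast <;> ring
  have hD : (0 : ℚ) < lam.den * (d + 1) := by positivity
  refine ⟨lam + 1 / (lam.den * (d + 1)), lt_add_of_pos_right _ (one_div_pos.mpr hD), ?_⟩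
  set mu := lam + 1 / (lam.den * (d + 1)) with hmu
  have hmain (x : L) : (x : V) ∈ hΦ.slopePart lam ⊔ hΦ.slopeGE mu := by
    obtain ⟨a, ha, hb⟩ := exists_fitting hg' f _ hfsmul x
    rw [← sub_add_cancel (x : V) a]
    refine Submodule.add_mem_sup ⟨L, hL, ?_⟩ ?_
    · rintro ⟨⟨j, n⟩, hjn⟩
      obtain ⟨z, hz⟩ := hb n.natAbs
      obtain ⟨u, hu⟩ := hpow n.natAbs z
      rw [← Submodule.coe_sub, hz, hu, hΦ.twist_smul', rescale_C]
      refine L.smul_mem _ ((hΦ.twist_twist_mem_iff _ _ _ _ _).mpr (hst _ _ ⟨?_, ?_⟩ _ z.2))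
      · have : (n.natAbs : ℤ) ≤ lam.den * n.natAbs :=
          le_mul_of_one_le_left (Int.natCast_nonneg _) (by exact_mod_cast lam.pos)
        have := neg_abs_le n
        rw [Int.abs_eq_natAbs] at this
        linarith
      · have hjn' : (0 : ℚ) ≤ j + lam * n := hjn
        push_cast
        rw [hlam]
        linarith
    · obtain ⟨L', hL', hy⟩ := exists_fg_y_zpow_smul_mem (m := m) (-1) hL
      refine ⟨L', hL', ?_⟩
      rintro ⟨⟨j, n⟩, hn, hjn⟩
      dsimp only at hn hjn ⊢
      let D : ℤ := lam.den * (d + 1)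
      have hDpos : 0 < D := mul_pos (by exact_mod_cast lam.pos) (by positivity)
      have hDQ : (D : ℚ) = lam.den * (d + 1) := by push_cast [D]; ring
      -- write `n = D k + i` and use the bound for the `k`-th power of `f ^ (d + 1)`
      obtain ⟨k, hk⟩ := Int.eq_ofNat_of_zero_le (Int.ediv_nonneg hn hDpos.le)
      have hi := Int.emod_nonneg n hDpos.ne'
      have hi' := Int.emod_lt_of_pos n hDpos
      have hni := Int.emod_add_mul_ediv n D
      rw [hk] at hni
      set i := n % D
      obtain ⟨z, hz⟩ := ha k
      obtain ⟨u, hu⟩ := hpow ((d + 1) * k) a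
      have hz' : twist m Φ (-lam.num * ((d + 1) * k : ℕ)) (lam.den * ((d + 1) * k : ℕ)) (a : V) =
          twist m Φ k 0 (PowerSeries.C ((u⁻¹ : ℂˣ) : ℂ) • (z : V)) := by
        rw [twist_apply Φ k, zpow_zero, LinearEquiv.coe_one, id, y_pow_smul, smul_comm,
          ← Submodule.coe_smul, ← hz, hu, smul_smul, ← map_mul, ← Units.val_mul, inv_mul_cancel,
          Units.val_one, map_one, one_smul]
      have hn' : n = i + lam.den * ((d + 1) * k : ℕ) := by
        rw [← hni]; push_cast [D]; ring
      have hj' : j = (j + lam.num * ((d + 1) * k : ℕ)) + -lam.num * ((d + 1) * k : ℕ) := by ring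
      rw [hn', hj', ← hΦ.twist_twist_mem_iff, hz', hΦ.twist_twist_mem_iff]
      have key := hy _ (hst (j + lam.num * ((d + 1) * k : ℕ) + k + 1) i ⟨hi, ?_⟩ _
        (L.smul_mem (PowerSeries.C ((u⁻¹ : ℂˣ) : ℂ)) z.2))
      · rw [y_zpow_smul_twist] at key
        convert key using 3 <;> ring
      · have h1 : (n : ℚ) = i + D * k := by rw [← hni]; push_cast; ring
        have h2 : (i : ℚ) ≤ D := by exact_mod_cast hi'.le
        rw [h1, hmu, ← hDQ] at hjn
        have h0 : (0 : ℚ) < D := by exact_mod_cast hDpos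
        have h3 : (lam + 1 / (D : ℚ)) * (i + D * k) = lam * i + lam * D * k + i / D + k := by
          field_simp; ring
        have h4 : (i : ℚ) / D ≤ 1 := (div_le_one h0).mpr h2
        rw [h3] at hjn
        push_cast
        rw [hlam]
        rw [hDQ] at hjn h4
        linarith
  rw [eq_top_iff, ← b.span_eq, Submodule.span_le]
  rintro _ ⟨i, rfl⟩
  exact hmain ⟨b i, hbL (Submodule.subset_span ⟨i, rfl⟩)⟩

end Split

/-! ### Newton polygons -/

section Order

variable {m : ℕ+} {s t : ℚ} {f g : K m}

/-- The order of vanishing of `f` in `y_m` is at least `t`. -/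
def OrdGE (t : ℚ) (f : K m) : Prop :=
  ∀ k : ℤ, (k : ℚ) < t → HahnSeries.coeff (Γ := ℤ) (R := ℂ) f k = 0

/-- The order of vanishing of `f` in `y_m` is larger than `t`. -/
def OrdGT (t : ℚ) (f : K m) : Prop :=
  ∀ k : ℤ, (k : ℚ) ≤ t → HahnSeries.coeff (Γ := ℤ) (R := ℂ) f k = 0

theorem OrdGE.zero : OrdGE t (0 : K m) := fun _ _ => rfl

theorem OrdGT.zero : OrdGT t (0 : K m) := fun _ _ => rfl

theorem ordGE_iff (hf : f ≠ 0) : OrdGE t f ↔ t ≤ ord f := by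
  constructor
  · intro h
    by_contra hlt
    exact HahnSeries.coeff_order_eq_zero.not.mpr hf (h _ (not_le.mp hlt))
  · intro h k hk
    exact HahnSeries.coeff_eq_zero_of_lt_order (by exact_mod_cast hk.trans_le h)

theorem ordGT_iff (hf : f ≠ 0) : OrdGT t f ↔ t < ord f := by
  constructor
  · intro h
    by_contra hlt
    exact HahnSeries.coeff_order_eq_zero.not.mpr hf (h _ (not_lt.mp hlt))
  · intro h k hk
    exact HahnSeries.coeff_eq_zero_of_lt_order (by exact_mod_cast hk.trans_lt h)

theorem OrdGE.mono (hf : OrdGE t f) (h : s ≤ t) : OrdGE s f := fun k hk => hf k (hk.trans_le h)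

theorem OrdGE.add (hf : OrdGE t f) (hg : OrdGE t g) : OrdGE t (f + g) := fun k hk => by
  have := HahnSeries.coeff_add (Γ := ℤ) (R := ℂ) (x := f) (y := g) (a := k)
  rw [hf k hk, hg k hk, add_zero] at this
  exact this

theorem OrdGT.add (hf : OrdGT t f) (hg : OrdGT t g) : OrdGT t (f + g) := fun k hk => by
  have := HahnSeries.coeff_add (Γ := ℤ) (R := ℂ) (x := f) (y := g) (a := k)
  rw [hf k hk, hg k hk, add_zero] at this
  exact this

theorem OrdGT.neg (hf : OrdGT t f) : OrdGT t (-f) := fun k hk => by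
  have := HahnSeries.coeff_neg (Γ := ℤ) (R := ℂ) (x := f) (a := k)
  rw [hf k hk, neg_zero] at this
  exact this

theorem OrdGT.of_add_left (hf : OrdGT t f) (h : OrdGT t (f + g)) : OrdGT t g := by
  simpa using hf.neg.add h

theorem ord_mul (hf : f ≠ 0) (hg : g ≠ 0) : ord (f * g) = ord f + ord g :=
  HahnSeries.order_mul hf hg

theorem OrdGE.mul (hf : OrdGE s f) (hg : OrdGE t g) : OrdGE (s + t) (f * g) := by
  by_cases hf0 : f = 0
  · rw [hf0, zero_mul]; exact .zero
  by_cases hg0 : g = 0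
  · rw [hg0, mul_zero]; exact .zero
  rw [ordGE_iff hf0] at hf
  rw [ordGE_iff hg0] at hg
  rw [ordGE_iff (mul_ne_zero hf0 hg0), ord_mul hf0 hg0]
  push_cast; linarith

theorem OrdGT.mul (hf : OrdGT s f) (hg : OrdGE t g) : OrdGT (s + t) (f * g) := by
  by_cases hf0 : f = 0
  · rw [hf0, zero_mul]; exact .zero
  by_cases hg0 : g = 0
  · rw [hg0, mul_zero]; exact .zero
  rw [ordGT_iff hf0] at hf
  rw [ordGE_iff hg0] at hg
  rw [ordGT_iff (mul_ne_zero hf0 hg0), ord_mul hf0 hg0]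
  push_cast; linarith

theorem not_ordGT_mul (hf : ¬ OrdGT s f) (hg : ¬ OrdGT t g) : ¬ OrdGT (s + t) (f * g) := by
  have hf0 : f ≠ 0 := fun h => hf (h ▸ .zero)
  have hg0 : g ≠ 0 := fun h => hg (h ▸ .zero)
  rw [ordGT_iff hf0] at hf
  rw [ordGT_iff hg0] at hg
  rw [ordGT_iff (mul_ne_zero hf0 hg0), ord_mul hf0 hg0]
  push_cast; linarith

theorem coeff_dil_eq_zero (c : ℂˣ) (k : ℤ) :
    HahnSeries.coeff (Γ := ℤ) (R := ℂ) (dil c m f) k = 0 ↔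
      HahnSeries.coeff (Γ := ℤ) (R := ℂ) f k = 0 :=
  mul_eq_zero_iff_left (zpow_ne_zero k c.ne_zero)

theorem ordGE_dil (c : ℂˣ) : OrdGE t (dil c m f) ↔ OrdGE t f :=
  forall₂_congr fun k _ => coeff_dil_eq_zero c k

theorem ordGT_dil (c : ℂˣ) : OrdGT t (dil c m f) ↔ OrdGT t f :=
  forall₂_congr fun k _ => coeff_dil_eq_zero c k

theorem ord_y_zpow (j : ℤ) : ord (y m ^ j) = j := by
  rw [y_zpow]; exact HahnSeries.order_single one_ne_zero

theorem ordGE_y_zpow (j : ℤ) : OrdGE j (y m ^ j) :=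
  (ordGE_iff (zpow_ne_zero j (y_ne_zero m))).mpr (by rw [ord_y_zpow])

theorem ordGE_algebraMap (r : ℂ⟦X⟧) : OrdGE 0 (algebraMap ℂ⟦X⟧ (K m) r) := fun k hk => by
  have := PowerSeries.coeff_coe (R := ℂ) r k
  rw [if_pos (by exact_mod_cast hk)] at this
  exact this

theorem OrdGE.exists_eq {N : ℤ} (hf : OrdGE N f) :
    ∃ r : ℂ⟦X⟧, f = y m ^ N * algebraMap ℂ⟦X⟧ (K m) r := by
  by_cases hf0 : f = 0
  · exact ⟨0, by rw [hf0, map_zero, mul_zero]⟩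
  rw [ordGE_iff hf0] at hf
  obtain ⟨k, hk⟩ := Int.le.dest (by exact_mod_cast hf : N ≤ ord f)
  obtain ⟨r, hr⟩ := exists_eq_y_zpow_ord_mul f
  refine ⟨PowerSeries.X ^ k * r, ?_⟩
  rw [map_mul, map_pow, algebraMap_X, ← mul_assoc, ← zpow_natCast, ← zpow_add₀ (y_ne_zero m), hk]
  exact hr

theorem OrdGE.one : OrdGE 0 (1 : K m) := by simpa using ordGE_y_zpow (m := m) 0

theorem not_ordGT_one : ¬ OrdGT 0 (1 : K m) := by
  have := ord_y_zpow (m := m) 0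
  rw [zpow_zero] at this
  rw [ordGT_iff one_ne_zero, this]; simp

end Order

section Newton

variable {m : ℕ+} (c : ℂˣ) (d : ℕ) (a : ℕ → K m)

/-- The coordinates of `Φ (∑ x_i e_i)`, where `Φ e_i = e_{i+1}` for `i < d` and
`Φ e_d = ∑ a_i e_i`; the index `i` runs from `0` to `d`. -/
def companion (x : ℕ → K m) : ℕ → K m
  | 0 => dil c m (x d) * a 0
  | i + 1 => dil c m (x i) + dil c m (x d) * a (i + 1)

variable {c d a} {lam t : ℚ} {x : ℕ → K m}

theorem ordGE_companion (ha : ∀ i ≤ d, OrdGE ((d + 1 - i) * lam) (a i))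
    (hx : ∀ i ≤ d, OrdGE (t - lam * i) (x i)) :
    ∀ i ≤ d, OrdGE (t + lam - lam * i) (companion c d a x i) := by
  have hmul (i : ℕ) (hi : i ≤ d) : OrdGE (t + lam - lam * i) (dil c m (x d) * a i) := by
    convert ((ordGE_dil c).mpr (hx d le_rfl)).mul (ha i hi) using 1
    ring
  rintro (_ | i) hi
  · exact hmul 0 hi
  · refine OrdGE.add ?_ (hmul _ hi)
    convert (ordGE_dil c).mpr (hx i (by lia)) using 1
    push_cast; ring

/-- The vectors whose leading term is concentrated in the coordinates `i ≥ j` are stable, if `j` is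
the first index at which `a` attains the slope `λ`. Their order grows by exactly `λ`. -/
theorem not_ordGT_companion {j : ℕ} (hj : j ≤ d)
    (ha : ∀ i ≤ d, OrdGE ((d + 1 - i) * lam) (a i))
    (ha' : ∀ i < j, OrdGT ((d + 1 - i) * lam) (a i))
    (haj : ¬ OrdGT ((d + 1 - j) * lam) (a j))
    (hx : ∀ i ≤ d, OrdGE (t - lam * i) (x i))
    (hx' : ∀ i < j, OrdGT (t - lam * i) (x i))
    (hxe : ∃ i ≤ d, ¬ OrdGT (t - lam * i) (x i)) :
    (∀ i < j, OrdGT (t + lam - lam * i) (companion c d a x i)) ∧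
      ∃ i ≤ d, ¬ OrdGT (t + lam - lam * i) (companion c d a x i) := by
  have hsucc (i : ℕ) (h : OrdGT (t - lam * i) (x i)) :
      OrdGT (t + lam - lam * (i + 1 : ℕ)) (dil c m (x i)) := by
    convert (ordGT_dil c).mpr h using 1
    push_cast; ring
  have hadd (i : ℕ) : t + lam - lam * i = (t - lam * d) + (d + 1 - i) * lam := by ring
  constructor
  · have hmul (i : ℕ) (hi : i < j) : OrdGT (t + lam - lam * i) (dil c m (x d) * a i) := by
      rw [hadd, add_comm, mul_comm (dil c m (x d))]
      exact (ha' i hi).mul ((ordGE_dil c).mpr (hx d le_rfl))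
    rintro (_ | i) hi
    · exact hmul 0 hi
    · exact (hsucc i (hx' i (by lia))).add (hmul _ hi)
  · by_cases hd : OrdGT (t - lam * d) (x d)
    · obtain ⟨i, hi, hxi⟩ := hxe
      have hne : i ≠ d := fun h => hxi (h ▸ hd)
      refine ⟨i + 1, by lia, fun h => hxi ?_⟩
      have h1 : OrdGT (t + lam - lam * (i + 1 : ℕ)) (dil c m (x d) * a (i + 1)) := by
        rw [hadd]
        exact ((ordGT_dil c).mpr hd).mul (ha (i + 1) (by lia))
      have h2 := h1.of_add_left (g := dil c m (x i)) (by rw [add_comm (_ * _)]; exact h)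
      rw [ordGT_dil] at h2
      convert h2 using 1
      push_cast; ring
    · have h1 : ¬ OrdGT (t + lam - lam * j) (dil c m (x d) * a j) := by
        rw [hadd]
        exact not_ordGT_mul ((ordGT_dil c).not.mpr hd) haj
      refine ⟨j, hj, ?_⟩
      rcases j with _ | j
      · exact h1
      · exact fun h => h1 ((hsucc j (hx' j (by lia))).of_add_left h)

end Newton

section Cyclic

variable {c : ℂˣ} {m : ℕ+} {V : Type*} [AddCommGroup V] [Module (K m) V] {Φ : V ≃ₗ[ℤ] V}

theorem IsDil.pow_sum_smul (hΦ : IsDil c m Φ) {d : ℕ} {a : ℕ → K m} {v : V}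
    (ha : (Φ ^ (d + 1)) v = ∑ i ∈ Finset.range (d + 1), a i • (Φ ^ i) v) (x : ℕ → K m) (n : ℕ) :
    (Φ ^ n) (∑ i ∈ Finset.range (d + 1), x i • (Φ ^ i) v) =
      ∑ i ∈ Finset.range (d + 1), ((companion c d a)^[n] x) i • (Φ ^ i) v := by
  induction n with
  | zero => simp
  | succ n ih =>
    rw [pow_succ', LinearEquiv.mul_apply, ih, Function.iterate_succ_apply', map_sum]
    generalize (companion c d a)^[n] x = z
    have h (i : ℕ) : Φ (z i • (Φ ^ i) v) = dil c m (z i) • (Φ ^ (i + 1)) v := by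
      rw [hΦ, pow_succ', LinearEquiv.mul_apply]
    simp only [h]
    rw [Finset.sum_range_succ, ha, Finset.sum_range_succ' (fun i => companion c d a z i • _)]
    simp only [companion, add_smul, Finset.sum_add_distrib, mul_smul]
    rw [Finset.sum_range_succ' (fun i => a i • _), smul_add, Finset.smul_sum, add_assoc]

/-- A relation of minimal length between the iterates of `v`, together with the least slope `λ` of
its Newton polygon and the first index `j` at which `λ` is attained. -/
theorem exists_minimal_relation (m : ℕ+) {V : Type*} [AddCommGroup V] [Module (K m) V]
    [FiniteDimensional (K m) V] (Φ : V ≃ₗ[ℤ] V) {v : V} (hv : v ≠ 0) :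
    ∃ (d : ℕ) (a : ℕ → K m) (lam : ℚ) (j : ℕ),
      LinearIndependent (K m) (fun i : Fin (d + 1) => (Φ ^ (i : ℕ)) v) ∧
      (Φ ^ (d + 1)) v = ∑ i ∈ Finset.range (d + 1), a i • (Φ ^ i) v ∧
      j ≤ d ∧ (∀ i ≤ d, OrdGE ((d + 1 - i) * lam) (a i)) ∧
      (∀ i < j, OrdGT ((d + 1 - i) * lam) (a i)) ∧ ¬ OrdGT ((d + 1 - j) * lam) (a j) := by
  classical
  have hex : ∃ n, ¬ LinearIndependent (K m) (fun i : Fin n => (Φ ^ (i : ℕ)) v) :=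
    ⟨Module.finrank (K m) V + 1, fun h => by simpa using h.fintype_card_le_finrank⟩
  obtain ⟨d, hd⟩ : ∃ d, Nat.find hex = d + 2 := by
    refine Nat.exists_eq_add_of_le' ((Nat.le_find_iff hex 2).mpr fun n hn => not_not.mpr ?_)
    interval_cases n
    · exact linearIndependent_empty_type
    · exact linearIndependent_unique_iff.mpr (by simpa using hv)
  have hli : LinearIndependent (K m) (fun i : Fin (d + 1) => (Φ ^ (i : ℕ)) v) := by
    have := Nat.find_min hex (m := d + 1) (by lia)
    exact not_not.mp this
  have hnot := Nat.find_spec hex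
  rw [hd, linearIndependent_finSucc', not_and, not_not] at hnot
  obtain ⟨a', ha'⟩ := (Submodule.mem_span_range_iff_exists_fun _).mp (hnot hli)
  let a (i : ℕ) : K m := if h : i < d + 1 then a' ⟨i, h⟩ else 0
  have ha : (Φ ^ (d + 1)) v = ∑ i ∈ Finset.range (d + 1), a i • (Φ ^ i) v := by
    rw [Finset.sum_range]
    refine Eq.trans ha'.symm (Finset.sum_congr rfl fun i _ => ?_)
    simp only [a, dif_pos i.2, Fin.init, Fin.val_castSucc]
  let S := (Finset.range (d + 1)).filter fun i => a i ≠ 0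
  have hS : S.Nonempty := by
    rw [Finset.nonempty_iff_ne_empty]
    intro h
    rw [Finset.filter_eq_empty_iff] at h
    rw [Finset.sum_eq_zero fun i hi => by rw [not_not.mp (h hi), zero_smul]] at ha
    exact hv ((LinearEquiv.map_eq_zero_iff _).mp ha)
  have hpos {i : ℕ} (hi : i ≤ d) : (0 : ℚ) < d + 1 - i := by
    have : (i : ℚ) ≤ d := by exact_mod_cast hi
    linarith
  obtain ⟨j, hjS, hj⟩ := S.exists_min_image
    (fun i => toLex ((ord (a i) / (d + 1 - i) : ℚ), i)) hS
  simp only [S, Finset.mem_filter, Finset.mem_range, Nat.lt_succ_iff, Prod.Lex.toLex_le_toLex]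
    at hjS hj
  refine ⟨d, a, ord (a j) / (d + 1 - j), j, hli, ha, hjS.1, fun i hi => ?_, fun i hi => ?_, ?_⟩
  · by_cases hai : a i = 0
    · rw [hai]; exact .zero
    rw [ordGE_iff hai, ← le_div_iff₀' (hpos hi)]
    rcases hj i ⟨hi, hai⟩ with h | h
    · exact h.le
    · exact h.1.le
  · by_cases hai : a i = 0
    · rw [hai]; exact .zero
    have hi' : i ≤ d := by lia
    rw [ordGT_iff hai, ← lt_div_iff₀' (hpos hi')]
    rcases hj i ⟨hi', hai⟩ with h | h
    · exact h
    · exact absurd h.2 (by lia)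
  · rw [ordGT_iff hjS.2, mul_div_cancel₀ _ (hpos hjS.1).ne']
    exact lt_irrefl _

variable [Module ℂ⟦X⟧ V] [IsScalarTower ℂ⟦X⟧ (K m) V]

theorem exists_forall_ordGE_of_fg {ι : Type*} [Finite ι] (φ : V →ₗ[K m] (ι → K m))
    {L : Submodule ℂ⟦X⟧ V} (hL : L.FG) : ∃ N : ℤ, ∀ x ∈ L, ∀ i, OrdGE N (φ x i) := by
  induction L, hL using Submodule.fg_induction with
  | singleton x =>
    obtain ⟨N, hN⟩ := (Set.finite_range fun i => ord (φ x i)).bddBelow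
    refine ⟨N, fun z hz i => ?_⟩
    obtain ⟨r, rfl⟩ := Submodule.mem_span_singleton.mp hz
    rw [← algebraMap_smul (K m) r, map_smul, Pi.smul_apply, smul_eq_mul, ← zero_add (N : ℚ)]
    refine (ordGE_algebraMap r).mul ?_
    by_cases h : φ x i = 0
    · rw [h]; exact .zero
    rw [ordGE_iff h]
    exact_mod_cast hN ⟨i, rfl⟩
  | sup L₁ L₂ _ _ h₁ h₂ =>
    obtain ⟨N₁, h₁⟩ := h₁
    obtain ⟨N₂, h₂⟩ := h₂
    refine ⟨min N₁ N₂, fun z hz i => ?_⟩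
    obtain ⟨z₁, hz₁, z₂, hz₂, rfl⟩ := Submodule.mem_sup.mp hz
    rw [map_add]
    exact ((h₁ z₁ hz₁ i).mono (by simp)).add ((h₂ z₂ hz₂ i).mono (by simp))

/-- Every nonzero vector `v` has slopes `≥ λ` for some `λ` that really occurs as a slope of `V`:
some `w` does not have slopes `≥ μ` for any `μ > λ`. Here `λ` is the least slope of the Newton
polygon of a relation between the iterates of `v`. -/
theorem IsDil.exists_newton_slope [FiniteDimensional (K m) V] (hΦ : IsDil c m Φ) {v : V}
    (hv : v ≠ 0) :
    ∃ lam : ℚ, v ∈ hΦ.slopeGE lam ∧ ∃ w, ∀ mu > lam, w ∉ hΦ.slopeGE mu := by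
  obtain ⟨d, a, lam, j, hli, hrel, hj, ha, ha', haj⟩ := exists_minimal_relation m Φ hv
  refine ⟨lam, ?_, (Φ ^ d) v, fun mu hmu hw => ?_⟩
  · let N : ℤ := ⌈|lam| * d⌉
    refine ⟨Submodule.span _ (Set.range fun i : Fin (d + 1) => y m ^ (-N) • (Φ ^ (i : ℕ)) v),
      Submodule.fg_span (Set.finite_range _), ?_⟩
    have hx (n : ℕ) : ∀ i ≤ d,
        OrdGE (n * lam - lam * i) ((companion c d a)^[n] (Pi.single 0 1) i) := by
      induction n with
      | zero =>
        rintro (_ | i) _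
        · simpa using OrdGE.one
        · simpa using OrdGE.zero
      | succ n ih =>
        rw [Function.iterate_succ_apply']
        convert ordGE_companion ha ih using 4
        push_cast; ring
    have hv' : v = ∑ i ∈ Finset.range (d + 1), (Pi.single 0 1 : ℕ → K m) i • (Φ ^ i) v := by
      rw [Finset.sum_eq_single 0] <;> simp +contextual
    rintro ⟨⟨k, n⟩, hn, hkn⟩
    obtain ⟨n, rfl⟩ := Int.eq_ofNat_of_zero_le hn
    dsimp only at hkn ⊢
    rw [twist_apply, zpow_natCast]
    conv => enter [2, 2]; rw [hv']
    rw [hΦ.pow_sum_smul hrel, Finset.smul_sum]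
    refine sum_mem fun i hi => ?_
    have hi' : i ≤ d := by simpa [Nat.lt_succ_iff] using hi
    have hge : OrdGE ((-N : ℤ) : ℚ) (y m ^ k * (companion c d a)^[n] (Pi.single 0 1) i) := by
      refine ((ordGE_y_zpow k).mul (hx n i hi')).mono ?_
      have h1 : |lam| * d ≤ N := Int.le_ceil _
      have h2 : lam * i ≤ |lam| * d := by
        have : (i : ℚ) ≤ d := by exact_mod_cast hi'
        gcongr
        exact le_abs_self lam
      push_cast at hkn ⊢
      linarith
    obtain ⟨r, hr⟩ := hge.exists_eq
    rw [smul_smul, hr, mul_comm, mul_smul, algebraMap_smul]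
    exact Submodule.smul_mem _ _
      (Submodule.subset_span ⟨⟨i, Nat.lt_succ_of_le hi'⟩, rfl⟩)
  · obtain ⟨L, hL, hw⟩ := hw
    obtain ⟨φ, hφ⟩ := LinearMap.exists_leftInverse_of_injective
      (Fintype.linearCombination (K m) fun i : Fin (d + 1) => (Φ ^ (i : ℕ)) v)
      (LinearMap.ker_eq_bot.mpr (hli.fintypeLinearCombination_injective))
    obtain ⟨N, hN⟩ := exists_forall_ordGE_of_fg φ hL
    let x (n : ℕ) : ℕ → K m := (companion c d a)^[n] (Pi.single d 1)
    have hx (n : ℕ) : (∀ i ≤ d, OrdGE (lam * d + n * lam - lam * i) (x n i)) ∧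
        (∀ i < j, OrdGT (lam * d + n * lam - lam * i) (x n i)) ∧
        ∃ i ≤ d, ¬ OrdGT (lam * d + n * lam - lam * i) (x n i) := by
      induction n with
      | zero =>
        have h0 (i : ℕ) (hi : i ≠ d) : x 0 i = 0 := Pi.single_eq_of_ne hi 1
        have h1 : x 0 d = 1 := Pi.single_eq_same d 1
        refine ⟨fun i _ => ?_, fun i hi => ?_, d, le_rfl, ?_⟩
        · by_cases hi : i = d
          · rw [hi, h1]; simpa using OrdGE.one
          · rw [h0 i hi]; exact .zero
        · rw [h0 i (by lia)]; exact .zero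
        · rw [h1]; simpa using not_ordGT_one
      | succ n ih =>
        have hsucc : x (n + 1) = companion c d a (x n) := Function.iterate_succ_apply' _ _ _
        have ht : lam * d + (n + 1 : ℕ) * lam = lam * d + n * lam + lam := by push_cast; ring
        rw [hsucc, ht]
        exact ⟨ordGE_companion ha ih.1, not_ordGT_companion hj ha ha' haj ih.1 ih.2.1 ih.2.2⟩
    have hφx (n : ℕ) (i : Fin (d + 1)) : φ ((Φ ^ n) ((Φ ^ d) v)) i = x n i := by
      have hd : (Φ ^ d) v =
          ∑ i ∈ Finset.range (d + 1), (Pi.single d 1 : ℕ → K m) i • (Φ ^ i) v := by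
        rw [Finset.sum_eq_single d] <;> simp +contextual
      rw [hd, hΦ.pow_sum_smul hrel, Finset.sum_range]
      exact congrFun (LinearMap.congr_fun hφ fun i : Fin (d + 1) => x n i) i
    obtain ⟨n, hn⟩ := exists_nat_gt ((|lam| * d + 1 - N) / (mu - lam))
    rw [div_lt_iff₀ (sub_pos.mpr hmu)] at hn
    obtain ⟨i, hi, hni⟩ := (hx n).2.2
    -- the least exponent allowed with `Φ ^ n` for the slope `μ`
    have h1 := hN _ (hw ⟨(⌈-(mu * n)⌉, n), Int.natCast_nonneg n, by
      have := Int.le_ceil (-(mu * n))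
      push_cast; linarith⟩) ⟨i, Nat.lt_succ_of_le hi⟩
    rw [twist_apply, map_smul, zpow_natCast, Pi.smul_apply, hφx, smul_eq_mul] at h1
    have hne : x n i ≠ 0 := fun h => hni (h ▸ .zero)
    have hy := zpow_ne_zero ⌈-(mu * n)⌉ (y_ne_zero m)
    rw [ordGE_iff (mul_ne_zero hy hne), ord_mul hy hne, ord_y_zpow] at h1
    rw [ordGT_iff hne, not_lt] at hni
    have h2 := Int.ceil_lt_add_one (-(mu * n))
    have h3 : lam * (d - i) ≤ |lam| * d := by
      have h4 : (i : ℚ) ≤ d := by exact_mod_cast hi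
      have h5 : (0 : ℚ) ≤ i := Nat.cast_nonneg i
      calc lam * (d - i) ≤ |lam| * (d - i) :=
            mul_le_mul_of_nonneg_right (le_abs_self lam) (by linarith)
        _ ≤ |lam| * d := mul_le_mul_of_nonneg_left (by linarith) (abs_nonneg lam)
    push_cast at h1
    linarith

end Cyclic

/-! ### Generation by the slope parts, and purity -/

section Functoriality

variable {c : ℂˣ} {m : ℕ+} {V W : Type*} [AddCommGroup V] [Module (K m) V]
  [AddCommGroup W] [Module (K m) W] {Φ : V ≃ₗ[ℤ] V} {Ψ : W ≃ₗ[ℤ] W}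

theorem map_zpow_of_intertwine {V W : Type*} [AddCommGroup V] [AddCommGroup W] {Φ : V ≃ₗ[ℤ] V}
    {Ψ : W ≃ₗ[ℤ] W} (φ : W →+ V) (h : ∀ w, φ (Ψ w) = Φ (φ w)) (n : ℤ) (w : W) :
    φ ((Ψ ^ n) w) = (Φ ^ n) (φ w) := by
  have hnat (n : ℕ) (w : W) : φ ((Ψ ^ n) w) = (Φ ^ n) (φ w) := by
    induction n with
    | zero => rfl
    | succ n ih => rw [pow_succ', pow_succ', LinearEquiv.mul_apply, LinearEquiv.mul_apply, h, ih]
  cases n with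
  | ofNat n => exact hnat n w
  | negSucc n =>
    rw [zpow_negSucc, zpow_negSucc]
    apply (Φ ^ (n + 1)).injective
    rw [← hnat]
    exact (congrArg φ ((Ψ ^ (n + 1)).apply_symm_apply w)).trans
      ((Φ ^ (n + 1)).apply_symm_apply _).symm

theorem map_twist_of_intertwine (φ : W →ₗ[K m] V) (h : ∀ w, φ (Ψ w) = Φ (φ w)) (j n : ℤ) (w : W) :
    φ (twist m Ψ j n w) = twist m Φ j n (φ w) := by
  rw [twist_apply, map_smul, twist_apply]
  exact congrArg _ (map_zpow_of_intertwine φ.toAddMonoidHom h n w)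

variable [Module ℂ⟦X⟧ V] [IsScalarTower ℂ⟦X⟧ (K m) V] [Module ℂ⟦X⟧ W]
  [IsScalarTower ℂ⟦X⟧ (K m) W] (hΦ : IsDil c m Φ) (hΨ : IsDil c m Ψ)

/-- Boundedness of orbits can be checked after an injective morphism. -/
theorem IsDil.mem_bdd_iff_of_injective (φ : W →ₗ[K m] V) (hφ : Function.Injective φ)
    (h : ∀ w, φ (Ψ w) = Φ (φ w)) {A : Set (ℤ × ℤ)} {w : W} :
    φ w ∈ hΦ.bdd A ↔ w ∈ hΨ.bdd A := by
  constructor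
  · rintro ⟨L, hL, hw⟩
    refine ⟨L.comap (φ.restrictScalars ℂ⟦X⟧), ?_, fun p => ?_⟩
    · exact Submodule.fg_of_fg_map_injective (φ.restrictScalars ℂ⟦X⟧) hφ
        (hL.of_le (Submodule.map_comap_le _ _))
    · rw [Submodule.mem_comap, LinearMap.restrictScalars_apply, map_twist_of_intertwine φ h]
      exact hw p
  · rintro ⟨L, hL, hw⟩
    refine ⟨L.map (φ.restrictScalars ℂ⟦X⟧), hL.map _, fun p => ?_⟩
    rw [← map_twist_of_intertwine φ h]
    exact Submodule.mem_map_of_mem (f := φ.restrictScalars ℂ⟦X⟧) (hw p)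

end Functoriality

section Generation

universe u

variable {c : ℂˣ} {m : ℕ+}

/-- The restriction of `Φ` to a subspace stable under `Φ` and `Φ⁻¹`. -/
def restrictEquiv {V : Type*} [AddCommGroup V] [Module (K m) V] (Φ : V ≃ₗ[ℤ] V)
    (W : Submodule (K m) V) (h : ∀ v ∈ W, Φ v ∈ W) (h' : ∀ v ∈ W, Φ.symm v ∈ W) : W ≃ₗ[ℤ] W where
  toFun w := ⟨Φ w, h w w.2⟩
  invFun w := ⟨Φ.symm w, h' w w.2⟩
  map_add' _ _ := Subtype.ext (map_add Φ _ _)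
  map_smul' _ _ := Subtype.ext (map_smul Φ _ _)
  left_inv _ := Subtype.ext (Φ.symm_apply_apply _)
  right_inv _ := Subtype.ext (Φ.apply_symm_apply _)

theorem IsDil.apply_mem_bdd {V : Type*} [AddCommGroup V] [Module (K m) V]
    [Module ℂ⟦X⟧ V] [IsScalarTower ℂ⟦X⟧ (K m) V] {Φ : V ≃ₗ[ℤ] V} (hΦ : IsDil c m Φ)
    {A : Set (ℤ × ℤ)} {v : V} (hv : v ∈ hΦ.bdd A) : Φ v ∈ hΦ.bdd A := by
  simpa [twist_apply] using hΦ.twist_mem_bdd 0 1 hv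

theorem IsDil.symm_apply_mem_bdd {V : Type*} [AddCommGroup V] [Module (K m) V]
    [Module ℂ⟦X⟧ V] [IsScalarTower ℂ⟦X⟧ (K m) V] {Φ : V ≃ₗ[ℤ] V} (hΦ : IsDil c m Φ)
    {A : Set (ℤ × ℤ)} {v : V} (hv : v ∈ hΦ.bdd A) : Φ.symm v ∈ hΦ.bdd A := by
  have := hΦ.twist_mem_bdd 0 (-1) hv
  rwa [twist_apply, zpow_zero, one_smul, zpow_neg_one] at this

/-- The least slope `λ` splits off, and the complement is of smaller dimension because some vector
does not have slopes `> λ`. -/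
theorem IsDil.iSup_slopePart_eq_top (N : ℕ) :
    ∀ (V : Type u) [AddCommGroup V] [Module (K m) V] [Module ℂ⟦X⟧ V]
      [IsScalarTower ℂ⟦X⟧ (K m) V] [FiniteDimensional (K m) V] (Φ : V ≃ₗ[ℤ] V)
      (hΦ : IsDil c m Φ), Module.finrank (K m) V = N → ⨆ lam, hΦ.slopePart lam = ⊤ := by
  induction N using Nat.strong_induction_on with
  | _ N ih =>
    intro V _ _ _ _ _ Φ hΦ hN
    rcases subsingleton_or_nontrivial V with hV | hV
    · exact Subsingleton.elim _ _
    let b := Module.finBasis (K m) V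
    have hne : Nonempty (Fin (Module.finrank (K m) V)) := b.index_nonempty
    choose lam hlam w hw using fun i => hΦ.exists_newton_slope (b.ne_zero i)
    obtain ⟨i₀, hi₀⟩ := Finite.exists_min lam
    have htop : hΦ.slopeGE (lam i₀) = ⊤ := by
      rw [eq_top_iff, ← b.span_eq, Submodule.span_le]
      rintro _ ⟨i, rfl⟩
      exact hΦ.slopeGE_anti (hi₀ i) (hlam i)
    obtain ⟨mu, hmu, hsup⟩ := hΦ.exists_slopePart_sup_slopeGE_eq_top htop
    set W := hΦ.slopeGE mu with hW
    let Ψ : W ≃ₗ[ℤ] W := restrictEquiv Φ W (fun v hv => hΦ.apply_mem_bdd hv)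
      (fun v hv => hΦ.symm_apply_mem_bdd hv)
    have hΨ : IsDil c m Ψ := fun f v => Subtype.ext (hΦ f v)
    have hlt : Module.finrank (K m) W < N := by
      rw [← hN]
      exact Submodule.finrank_lt fun h => hw i₀ mu hmu (by rw [← hW, h]; exact Submodule.mem_top)
    have hWtop := ih _ hlt W Ψ hΨ rfl
    rw [eq_top_iff, ← hsup, sup_le_iff]
    refine ⟨le_iSup hΦ.slopePart _, ?_⟩
    rw [← W.range_subtype, ← Submodule.map_top, ← hWtop, Submodule.map_iSup]
    refine iSup_mono fun nu => Submodule.map_le_iff_le_comap.mpr fun v hv => ?_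
    exact (hΦ.mem_bdd_iff_of_injective hΨ W.subtype W.subtype_injective fun _ => rfl).mpr hv

end Generation

section Ramification

variable {a : ℂ} {m : ℕ+} {V : Type*} [AddCommGroup V] [Module (K m) V]

/-- A difference operator, with only its additive structure. -/
def Operator.toInt (Φ : Operator a m V) : V ≃ₗ[ℤ] V := Φ.toAddEquiv.toIntLinearEquiv

theorem Operator.isDil_toInt (Φ : Operator a m V) : IsDil (qRoot a m) m Φ.toInt :=
  fun f v => map_smulₛₗ Φ f v

theorem ramify_y (m n : ℕ+) : ramify m n (y m) = y (m * n) ^ ((n : ℕ) : ℤ) := by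
  rw [y_zpow]
  exact (HahnSeries.embDomain_single (f := mulEmb n) (g := (1 : ℤ)) (r := (1 : ℂ))).trans
    (congrArg (fun k : ℤ => HahnSeries.single k (1 : ℂ)) (mul_one _))

theorem exists_ramify_algebraMap_eq (m n : ℕ+) (r : ℂ⟦X⟧) :
    ∃ r' : ℂ⟦X⟧, ramify m n (algebraMap ℂ⟦X⟧ (K m) r) = algebraMap ℂ⟦X⟧ (K (m * n)) r' := by
  have h : OrdGE (0 : ℤ) (ramify m n (algebraMap ℂ⟦X⟧ (K m) r)) := by
    intro k hk
    by_cases hkr : k ∈ Set.range (mulEmb n)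
    · obtain ⟨j, rfl⟩ := hkr
      refine HahnSeries.embDomain_coeff.trans (ordGE_algebraMap (m := m) r j ?_)
      have hk' : (n : ℤ) * j < 0 := by exact_mod_cast hk
      exact_mod_cast (pos_iff_neg_of_mul_neg hk').mp (by exact_mod_cast n.pos)
    · exact HahnSeries.embDomain_of_notMem_range hkr
  obtain ⟨r', hr'⟩ := h.exists_eq
  exact ⟨r', by rw [hr', zpow_zero, one_mul]⟩

/-- If all of `V` has slope `-m ω` with respect to `y_m`, the span over `ℛ_{mn}` of the vectors
`y_{mn} ^ j Φ ^ k (1 ⊗ v)`, with `j ≥ m n ω k` and `v` in a basis, is a lattice. -/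
theorem isPureIsoclinic_of_slopePart_eq_top [FiniteDimensional (K m) V] [Module ℂ⟦X⟧ V]
    [IsScalarTower ℂ⟦X⟧ (K m) V] (Φ : Operator a m V) {ω : ℚ}
    (h : Φ.isDil_toInt.slopePart (-((m : ℕ) * ω)) = ⊤) : IsPureIsoclinic Φ ω := by
  intro n l hl
  have hn : (0 : ℚ) < (n : ℕ) := by exact_mod_cast n.pos
  let Φ' : Operator a (m * n) (K (m * n) ⊗[K m] V) := pullback n Φ
  have hΦ' : IsDil (qRoot a (m * n)) (m * n) Φ'.toInt := Φ'.isDil_toInt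
  let φ : V →+ K (m * n) ⊗[K m] V := (TensorProduct.mk (K m) (K (m * n)) V 1).toAddMonoidHom
  have hφ (v : V) : φ (Φ.toInt v) = Φ'.toInt (φ v) := by
    change 1 ⊗ₜ[K m] Φ v = shift a (m * n) 1 ⊗ₜ[K m] Φ v
    rw [map_one]
  have hφy (j : ℤ) (v : V) : φ (y m ^ j • v) = y (m * n) ^ ((n : ℕ) * j : ℤ) • φ v := by
    change 1 ⊗ₜ[K m] (y m ^ j • v) = y (m * n) ^ ((n : ℕ) * j : ℤ) • (1 ⊗ₜ[K m] v)
    rw [← TensorProduct.smul_tmul, TensorProduct.smul_tmul', Algebra.smul_def, smul_eq_mul]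
    congr 2
    rw [map_zpow₀, zpow_mul]
    exact congrArg (· ^ j) (ramify_y m n)
  have hφr : ∃ τ : ℂ⟦X⟧ → ℂ⟦X⟧, ∀ r v, φ (r • v) = τ r • φ v := by
    choose τ hτ using exists_ramify_algebraMap_eq m n
    refine ⟨τ, fun r v => ?_⟩
    change 1 ⊗ₜ[K m] (r • v) = τ r • (1 ⊗ₜ[K m] v)
    rw [← algebraMap_smul (K m) r v, ← TensorProduct.smul_tmul, Algebra.smul_def, mul_one,
      TensorProduct.smul_tmul', Algebra.smul_def (τ r), mul_one]
    exact congrArg (· ⊗ₜ[K m] v) (hτ r)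
  obtain ⟨τ, hτ⟩ := hφr
  have hbdd (v : V) : φ v ∈ hΦ'.slopePart (-l) := by
    obtain ⟨L, hL, hv⟩ := (h ▸ Submodule.mem_top : v ∈ Φ.isDil_toInt.slopePart (-((m : ℕ) * ω)))
    obtain ⟨L₁, hL₁, hL₁m⟩ := exists_fg_y_zpow_smul_mem (m := m) (-1) hL
    obtain ⟨M, hM, hMm⟩ := exists_fg_forall_mem_of_pointwise (fun _ : Unit => φ) (fun _ => τ)
      (fun _ => hτ) hL₁ fun x _ => ⟨Submodule.span _ {φ x}, Submodule.fg_span_singleton _,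
        fun _ => Submodule.mem_span_singleton_self _⟩
    refine ⟨M, hM, ?_⟩
    rintro ⟨⟨j, k⟩, hjk⟩
    change (0 : ℚ) ≤ j + -l * k at hjk
    -- write `j = n j₀ + i` with `0 ≤ i < n`
    have hn0 : (0 : ℤ) < (n : ℕ) := by exact_mod_cast n.pos
    have hdiv := Int.emod_add_mul_ediv j (n : ℕ)
    have hi := Int.emod_nonneg j hn0.ne'
    have hi' := Int.emod_lt_of_pos j hn0
    set j₀ := j / ((n : ℕ) : ℤ)
    set i := j % ((n : ℕ) : ℤ)
    have key := hMm _ (hL₁m _ (hv ⟨(j₀ + 1, k), ?_⟩)) ()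
    · have := y_zpow_smul_mem (m := m * n) hi key
      dsimp only at this ⊢
      rw [y_zpow_smul_twist, twist_apply, hφy, smul_smul, ← zpow_add₀ (y_ne_zero _),
        map_zpow_of_intertwine φ hφ, show i + (n : ℕ) * (-1 + (j₀ + 1)) = j by
          rw [← hdiv]; ring] at this
      exact this
    · change (0 : ℚ) ≤ ((j₀ + 1 : ℤ) : ℚ) + -((m : ℕ) * ω) * k
      have h1 : (j : ℚ) ≤ (n : ℕ) * ((j₀ + 1 : ℤ) : ℚ) := by
        have : j ≤ (n : ℕ) * (j₀ + 1) := by linarith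
        exact_mod_cast this
      have h2 : (l : ℚ) = (n : ℕ) * ((m : ℕ) * ω) := by rw [hl]; push_cast; ring
      rw [h2] at hjk
      refine nonneg_of_mul_nonneg_right (a := ((n : ℕ) : ℚ)) ?_ hn
      linarith
  let b := Module.finBasis (K m) V
  let b' := Algebra.TensorProduct.basis (K (m * n)) b
  have hb' (i) : b' i = φ (b i) := Algebra.TensorProduct.basis_apply b i
  have htop : hΦ'.slopePart (-l) = ⊤ := by
    rw [eq_top_iff, ← b'.span_eq, Submodule.span_le]
    rintro _ ⟨i, rfl⟩
    rw [hb']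
    exact hbdd _
  obtain ⟨L, hL, hbL, hst⟩ := hΦ'.exists_stable_of_bdd_eq_top (zero_mem_slopeHalfPlane _)
    (fun _ hp _ hq => add_mem_slopeHalfPlane hp hq) htop
    (Submodule.fg_span (R := ℂ⟦X⟧) (Set.finite_range b'))
  refine ⟨L, ⟨hL, ?_⟩, ?_⟩
  · rw [eq_top_iff, ← b'.span_eq]
    exact Submodule.span_mono (Submodule.subset_span.trans hbL)
  · have hmap (x) : y (m * n) ^ l • pullback n Φ x = twist (m * n) Φ'.toInt l 1 x := by
      rw [twist_apply, zpow_one]; rfl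
    have h1 : (l, (1 : ℤ)) ∈ slopeHalfPlane (-l) := by simp [slopeHalfPlane]
    have h2 : (-l, (-1 : ℤ)) ∈ slopeHalfPlane (-l) := by simp [slopeHalfPlane]
    ext x
    constructor
    · rintro ⟨z, hz, rfl⟩
      dsimp only
      rw [hmap]
      exact hst _ _ h1 z hz
    · intro hx
      -- the inverse of the twisted power is a twisted power up to a constant
      let u : ℂˣ := (qRoot a (m * n) ^ (1 : ℤ)) ^ (-l)
      refine ⟨twist (m * n) Φ'.toInt (-l) (-1) (PowerSeries.C ((u⁻¹ : ℂˣ) : ℂ) • x),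
        hst _ _ h2 _ (L.smul_mem _ hx), ?_⟩
      dsimp only
      rw [hmap, hΦ'.twist_twist, add_neg_cancel, add_neg_cancel, twist_zero_zero, smul_smul,
        ← map_mul, ← Units.val_mul, mul_inv_cancel, Units.val_one, map_one, one_smul]

end Ramification

end QDiff

end

theorem mainTheorem9 (a : ℂ) (m : ℕ+) (V : Type*) [AddCommGroup V] [Module (QDiff.K m) V]
    [FiniteDimensional (QDiff.K m) V] (Φ : QDiff.Operator a m V) :
    ∃ U : ℚ → Submodule (QDiff.K m) V, QDiff.IsSlopeDecomposition Φ U := by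
  let : Module ℂ⟦X⟧ V := Module.compHom V (algebraMap ℂ⟦X⟧ (QDiff.K m))
  have : IsScalarTower ℂ⟦X⟧ (QDiff.K m) V :=
    ⟨fun r f v => by rw [Algebra.smul_def, mul_smul]; rfl⟩
  have hm : ((m : ℕ) : ℚ) ≠ 0 := by exact_mod_cast m.ne_zero
  have hΦ := Φ.isDil_toInt
  -- slope `ω` means that `Φ ^ n` behaves as `y_m ^ (-m ω n)`
  let e : ℚ → ℚ := fun ω => -((m : ℕ) * ω)
  have he : Function.Injective e := fun x z h => mul_left_cancel₀ hm (neg_injective h)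
  have he' : Function.Surjective e := fun x => ⟨-x / (m : ℕ), by simp only [e]; field_simp⟩
  refine ⟨fun ω => hΦ.slopePart (e ω), ?_, fun ω => ?_, fun ω => ?_⟩
  · rw [DirectSum.isInternal_submodule_iff_iSupIndep_and_iSup_eq_top]
    exact ⟨hΦ.iSupIndep_slopePart.comp he,
      (he'.iSup_comp _).trans (QDiff.IsDil.iSup_slopePart_eq_top _ V _ hΦ rfl)⟩
  · refine le_antisymm (Submodule.map_le_iff_le_comap.mpr fun v hv => hΦ.apply_mem_bdd hv)
      fun v hv => ⟨Φ.symm v, hΦ.symm_apply_mem_bdd hv, Φ.apply_symm_apply v⟩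
  · refine QDiff.isPureIsoclinic_of_slopePart_eq_top _ (eq_top_iff.mpr fun v _ => ?_)
    exact (hΦ.mem_bdd_iff_of_injective _ (hΦ.slopePart (e ω)).subtype
      (Submodule.subtype_injective _) fun _ => rfl).mp v.2
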